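/- A generalized splice diagram $\Delta$ is a finite tree all of whose vertices have valency $1$ (leaves) or at least $3$ (nodes), together with a positive integer weight $d_{ve}$ for each node $v$ and each edge $e$ at $v$, such that for every edge joining two nodes the edge determinant (the product of the two weights on the edge minus the product of all weights adjacent to the edge at its two end nodes) is positive. The weights around a node need not be coprime, and weights equal to $1$ are allowed. Let $t$ be the number of leaves; attach a variable $z_w$ to each leaf $w$. For vertices $v\neq w$ let $\ell_{vw}$ be the product of all weights adjacent to, but not on, the path from $v$ to $w$ (including weights around $v$ and $w$). For a node $v$ of valency $\delta_v$ let $d_v=\prod_{e\ni v}d_{ve}$, and define the $v$-weight of a monomial $\prod_w z_w^{\alpha_w}$ to be $\sum_w\alpha_w\ell_{vw}$. A monomial is admissible for a node $v$ and an edge $e$ at $v$ if its $v$-weight is $d_v$ and it involves only variables $z_w$ of leaves $w$ for which the path from $v$ to $w$ begins with $e$. The semigroup condition says that an admissible monomial exists for every node $v$ and every edge $e$ at $v$. Theorem. Let $\Delta$ be a generalized splice diagram satisfying the semigroup condition. Choose for each node $v$ and each edge $e$ at $v$ an admissible monomial $M_{ve}$; for each node $v$ a complex $(\delta_v-2)\times\delta_v$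 matrix $(a_{v,i,e})$ all of whose maximal minors are nonzero; and for each node $v$ and each $1\le i\le\delta_v-2$ a polynomial $H_{v,i}\in\mathbb C[z_w]$ all of whose monomials have $v$-weight greater than $d_v$. (Such choices exist.) Then, for every such choice, the subscheme $X(\Delta)\subset\mathbb C^t$ defined by the equations $$\sum_{e\ni v} a_{v,i,e}M_{ve}+H_{v,i}=0\qquad(v\text{ a node},\ i=1,\dots,\delta_v-2)$$ has an isolated complete intersection surface singularity at the origin: there are exactly $t-2$ equations, the origin lies on $X(\Delta)$, the local ring of $X(\Delta)$ at the origin has dimension $2$, and there is a neighbourhood of the origin in $\mathbb C^t$ such that at every point of $X(\Delta)$ in it other than the origin the local ring of $X(\Delta)$ is regular of dimension $2$. (The origin itself is allowed to be a nonsingular point.) -/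

import Mathlib

open scoped Topology

namespace Splice

noncomputable section

open scoped Classical in
/-- A generalized splice diagram on the vertex set `V`: a finite tree whose vertices have
valency `1` (leaves) or at least `3` (nodes), with a positive integer weight `weight v u` at each
node `v` for each edge `vu` departing from `v`, such that every edge joining two nodes has positive
edge determinant. The weights around a node need not be coprime, and the weight `1` is allowed.
The values of `weight` at other pairs of vertices are irrelevant. -/
structure GenSpliceDiagram (V : Type*) [Fintype V] where
  graph : SimpleGraph V
  isTree : graph.IsTree
  valency : ∀ v, graph.degree v = 1 ∨ 3 ≤ graph.degree v
  weight : V → V → ℕ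
  weight_pos : ∀ v u, 3 ≤ graph.degree v → graph.Adj v u → 0 < weight v u
  edgeDet_pos : ∀ v u, 3 ≤ graph.degree v → 3 ≤ graph.degree u → graph.Adj v u →
    (∏ x ∈ (graph.neighborFinset v).erase u, weight v x) *
      (∏ x ∈ (graph.neighborFinset u).erase v, weight u x) < weight v u * weight u v

namespace GenSpliceDiagram

variable {V : Type*} [Fintype V] (D : GenSpliceDiagram V)

open scoped Classical in
/-- The vertices adjacent to `v`; they index the edges departing from `v`. -/
def nbrs (v : V) : Finset V := D.graph.neighborFinset v

/-- The number of edges at `v`. -/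
def val (v : V) : ℕ := (D.nbrs v).card

/-- The leaves; they index the variables. -/
abbrev Leaf : Type _ := {w : V // D.val w = 1}

/-- The nodes. -/
abbrev Node : Type _ := {v : V // 3 ≤ D.val v}

/-- The unique path in the tree from `v` to `w`. -/
def path (v w : V) : D.graph.Walk v w := (D.isTree.existsUnique_path v w).exists.choose

open scoped Classical in
/-- The linking number `ℓ_{vw}`: the product of all weights adjacent to, but not on, the path from
`v` to `w`, including the weights around the two end vertices. -/
def linking (v w : V) : ℕ :=
  ∏ x ∈ (D.path v w).support.toFinset,
    ∏ y ∈ (D.nbrs x).filter (fun y => s(x, y) ∉ (D.path v w).edges), D.weight x y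

/-- The weight of a node: the product of all the weights around it. -/
def nodeWeight (v : V) : ℕ := ∏ u ∈ D.nbrs v, D.weight v u

/-- The `v`-weight of the monomial with exponent vector `m`, where the variable of the leaf `w`
has weight `ℓ_{vw}`. -/
def monomialWeight (v : V) (m : D.Leaf →₀ ℕ) : ℕ := m.sum fun w a => a * D.linking v w

/-- `m` is the exponent vector of an admissible monomial for the node `v` and the edge `vu`: only
outer variables occur (those of leaves `w` such that the path from `v` to `w` runs along `vu`), and
the `v`-weight of the monomial is the weight of the node. -/
def Admissible (v u : V) (m : D.Leaf →₀ ℕ) : Prop :=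
  (∀ w ∈ m.support, s(v, u) ∈ (D.path v w).edges) ∧ D.monomialWeight v m = D.nodeWeight v

/-- The semigroup condition: every node has an admissible monomial in every direction. -/
def SemigroupCondition : Prop :=
  ∀ v : D.Node, ∀ u ∈ D.nbrs v, ∃ m : D.Leaf →₀ ℕ, D.Admissible v u m

/-- The choices entering a system of splice type equations: for each node `v` of valency `δ_v` an
admissible monomial for each edge at `v`, a `(δ_v - 2) × δ_v` coefficient matrix all of whose
maximal minors are nonzero, and for each of the `δ_v - 2` equations a polynomial all of whose
monomials have `v`-weight larger than the weight of `v`. -/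
structure System where
  expo : (v : D.Node) → D.nbrs v → (D.Leaf →₀ ℕ)
  admissible : ∀ (v : D.Node) (u : D.nbrs v), D.Admissible v u (expo v u)
  coeff : (v : D.Node) → Matrix (Fin (D.val v - 2)) (D.nbrs v) ℂ
  generic : ∀ (v : D.Node) (c : Fin (D.val v - 2) ↪ D.nbrs v),
    ((coeff v).submatrix id c).det ≠ 0
  higher : (v : D.Node) → Fin (D.val v - 2) → MvPolynomial D.Leaf ℂ
  higher_weight : ∀ (v : D.Node) (i : Fin (D.val v - 2)), ∀ m ∈ (higher v i).support,
    D.nodeWeight v < D.monomialWeight v m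

/-- The splice type equations: `∑ₑ aᵢₑ Mᵥₑ + Hᵥᵢ` for each node `v` and `i = 1, …, δ_v - 2`. -/
def System.equation {D : GenSpliceDiagram V} (S : D.System) :
    (Σ v : D.Node, Fin (D.val v - 2)) → MvPolynomial D.Leaf ℂ :=
  fun j => (∑ u, MvPolynomial.monomial (S.expo j.1 u) (S.coeff j.1 j.2 u)) + S.higher j.1 j.2

end GenSpliceDiagram

/-- The ideal of polynomials vanishing at the point `x`. -/
abbrev pointIdeal {σ : Type*} (x : σ → ℂ) : Ideal (MvPolynomial σ ℂ) :=
  RingHom.ker (MvPolynomial.eval x)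

instance pointIdeal_isPrime {σ : Type*} (x : σ → ℂ) : (pointIdeal x).IsPrime :=
  RingHom.ker_isPrime _

/-- The local ring at `x` of the subscheme of affine space `ℂ^σ` defined by the polynomials `f`
(meaningful when `x` is a common zero of `f`): the local ring of affine space at `x` modulo the
ideal generated by `f`. -/
abbrev LocalRingAt {σ ι : Type*} (f : ι → MvPolynomial σ ℂ) (x : σ → ℂ) : Type _ :=
  Localization.AtPrime (pointIdeal x) ⧸
    (Ideal.span (Set.range f)).map
      (algebraMap (MvPolynomial σ ℂ) (Localization.AtPrime (pointIdeal x)))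

/-- The polynomials `f` define a subscheme of `ℂ^σ` which has an isolated complete intersection
surface singularity at `p`: the point `p` lies on it, its local ring there has dimension `2`, the
number of equations is the codimension, and all points other than `p` in some neighbourhood
of `p` (in the classical topology) are nonsingular points of dimension `2`. As usual, `p` itself is
allowed to be a nonsingular point. -/
structure IsIsolatedCISurfaceSingularity {σ ι : Type*} (f : ι → MvPolynomial σ ℂ) (p : σ → ℂ) :
    Prop where
  mem : ∀ j, MvPolynomial.eval p (f j) = 0
  dim_eq : ringKrullDim (LocalRingAt f p) = 2
  card_eq : Nat.card ι + 2 = Nat.card σ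
  isolated : ∀ᶠ x in 𝓝[≠] p, (∀ j, MvPolynomial.eval x (f j) = 0) →
    IsRegularLocalRing (LocalRingAt f x) ∧ ringKrullDim (LocalRingAt f x) = 2

end

end Splice

namespace Splice

/-! The proof studies points of $X(\Delta)$ in a field $K \supset \mathbb C$ with a valuation
trivial on $\mathbb C$, whose coordinates are not all zero and have valuation $<1$. For each node
$v$ the orders of the coordinates are compared with the weight vector $(\ell_{vw})_w$: take the
largest multiple $\mu_v$ of that vector lying below the orders, and let $W_v$ be the set of leaves
where equality holds. A monomial $M_{ve}$ is tight if all its leaves lie in $W_v$. Modulo smaller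
elements the equations at $v$ are generic linear relations between the $M_{ve}$, so two monomials
that are not tight force all of them to be not tight. Positive edge determinants (`linking_mul_le`)
relate the sets $W_v$ of different nodes. Together these facts show that at most one monomial at
each node fails to be tight (`tight_or_tight`), and that some node $u$ is a centre: at every other
node the monomial pointing towards $u$ is not tight (`exists_centre`).

Two consequences follow. Two monomials at one node never vanish together (`prod_ne_zero_or`), so
they cut $X(\Delta)$ down to the origin near the origin and the dimension is at most $2$; counting
equations gives at least $2$. Also the rows of the Jacobian matrix are independent over $K$
(`jacobian_rows_independent`): the leading terms of a relation would give a relation between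
exponent vectors, which `eq_zero_of_sum_expo_smul` excludes.

The first is applied to the function fields of subvarieties through the origin, the second to germs
along an ultrafilter of supposed bad points converging to the origin. The Jacobian criterion then
gives regularity near the origin. -/

theorem walk_snd_append {V : Type*} {G : SimpleGraph V} {a b c : V} {p : G.Walk a b}
    {q : G.Walk b c} (h : ¬ p.Nil) : (p.append q).snd = p.snd := by
  cases p with
  | nil => simp at h
  | cons h q => simp

/-! ### Paths and directions in the tree. -/

namespace GenSpliceDiagram

variable {V : Type*} [Fintype V] (D : GenSpliceDiagram V)

theorem mem_nbrs {v u : V} : u ∈ D.nbrs v ↔ D.graph.Adj v u := by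
  simp [nbrs]

theorem val_eq (v : V) : D.val v = 1 ∨ 3 ≤ D.val v := by
  classical
  have h : ∀ v, D.val v = D.graph.degree v := fun v => by
    rw [val, nbrs, SimpleGraph.degree]
  rw [h]
  convert D.valency v

theorem path_isPath (v w : V) : (D.path v w).IsPath :=
  (D.isTree.existsUnique_path v w).exists.choose_spec

theorem eq_path {v w : V} {p : D.graph.Walk v w} (hp : p.IsPath) : p = D.path v w :=
  (D.isTree.existsUnique_path v w).unique hp (D.path_isPath v w)

theorem path_self (v : V) : D.path v v = .nil := (D.eq_path .nil).symm

theorem path_reverse (v w : V) : (D.path v w).reverse = D.path w v :=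
  D.eq_path (D.path_isPath v w).reverse

/-- The vertex following `v` on the path from `v` to `w`; it is `v` itself if `v = w`. -/
noncomputable def dir (v w : V) : V := (D.path v w).snd

theorem dir_self (v : V) : D.dir v v = v := by simp [dir, path_self]

theorem adj_dir {v w : V} (h : v ≠ w) : D.graph.Adj v (D.dir v w) :=
  (D.path v w).adj_snd (SimpleGraph.Walk.not_nil_of_ne h)

theorem path_eq_cons {v w : V} (h : v ≠ w) :
    D.path v w = .cons (D.adj_dir h) (D.path (D.dir v w) w) := by
  have hn : ¬ (D.path v w).Nil := SimpleGraph.Walk.not_nil_of_ne h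
  have := D.eq_path (D.path_isPath v w).tail
  conv_lhs => rw [← SimpleGraph.Walk.cons_tail_eq _ hn]
  rw [this]; rfl

theorem dir_eq_of_adj {v u : V} (h : D.graph.Adj v u) : D.dir v u = u := by
  have : SimpleGraph.Walk.cons h .nil = D.path v u := D.eq_path (by simp [h.ne])
  rw [dir, ← this]; simp

theorem dir_mem_nbrs {v w : V} (h : v ≠ w) : D.dir v w ∈ D.nbrs v :=
  D.mem_nbrs.2 (D.adj_dir h)

theorem notMem_support_path {v w : V} (h : v ≠ w) : v ∉ (D.path (D.dir v w) w).support := by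
  have := D.path_isPath v w
  rw [D.path_eq_cons h] at this
  exact ((SimpleGraph.Walk.cons_isPath_iff _ _).1 this).2

theorem mem_edges_path {v u w : V} (h : D.graph.Adj v u) :
    s(v, u) ∈ (D.path v w).edges ↔ D.dir v w = u := by
  by_cases hvw : v = w
  · subst hvw
    simp [path_self, dir_self, h.ne]
  · have hn := D.notMem_support_path hvw
    rw [D.path_eq_cons hvw, SimpleGraph.Walk.edges_cons, List.mem_cons]
    constructor
    · rintro (h' | h')
      · have := Sym2.eq_iff.1 h'
        have := h.ne
        grind
      · exact absurd (SimpleGraph.Walk.fst_mem_support_of_mem_edges _ h') hn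
    · rintro rfl; simp

theorem dir_of_dir_ne {v u w : V} (h : D.graph.Adj v u) (h' : D.dir u w ≠ v) :
    D.dir v w = u := by
  by_cases huw : u = w
  · subst huw; exact D.dir_eq_of_adj h
  by_cases hv : v ∈ (D.path u w).support
  · exact absurd (D.isTree.isAcyclic.eq_snd_of_adj_start (D.path_isPath u w) h.symm hv) h'.symm
  · have : SimpleGraph.Walk.cons h (D.path u w) = D.path v w :=
      D.eq_path ((SimpleGraph.Walk.cons_isPath_iff _ _).2 ⟨D.path_isPath u w, hv⟩)
    rw [dir, ← this]; simp

/-- Removing an edge splits the tree in two, and `w` lies on exactly one side. -/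
theorem dir_eq_iff {v u w : V} (h : D.graph.Adj v u) : D.dir v w = u ↔ D.dir u w ≠ v := by
  refine ⟨fun h1 h2 => ?_, D.dir_of_dir_ne h⟩
  have hvw : v ≠ w := by rintro rfl; exact h.ne (by rw [← h1, dir_self])
  have huw : u ≠ w := by rintro rfl; exact h.ne (by rw [← h2, dir_self])
  have := D.notMem_support_path hvw
  rw [h1, D.path_eq_cons huw, SimpleGraph.Walk.support_cons, List.mem_cons, not_or, h2] at this
  exact this.2 (SimpleGraph.Walk.start_mem_support _)

theorem dir_dir {v w : V} (h : v ≠ w) : D.dir (D.dir v w) w ≠ v :=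
  (D.dir_eq_iff (D.adj_dir h)).1 rfl

theorem dir_dir_eq {v u : V} (hvu : v ≠ u) (hne : D.dir u v ≠ v) :
    D.dir v (D.dir u v) = D.dir v u := by
  have h1 : D.path v u = (D.path v (D.dir u v)).concat (D.adj_dir hvu.symm).symm := by
    rw [← D.path_reverse u v, D.path_eq_cons hvu.symm, SimpleGraph.Walk.reverse_cons,
      D.path_reverse, SimpleGraph.Walk.concat_eq_append]
  have h2 : ¬ (D.path v (D.dir u v)).Nil := SimpleGraph.Walk.not_nil_of_ne hne.symm
  change (D.path v (D.dir u v)).snd = (D.path v u).snd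
  rw [h1, SimpleGraph.Walk.concat_eq_append]
  exact (walk_snd_append h2).symm

theorem length_path {v w : V} (h : v ≠ w) :
    (D.path v w).length = (D.path (D.dir v w) w).length + 1 := by
  rw [D.path_eq_cons h]; simp

theorem path_induction (w : V) {P : V → Prop} (base : P w)
    (step : ∀ v, v ≠ w → P (D.dir v w) → P v) (v : V) : P v := by
  induction h : (D.path v w).length generalizing v with
  | zero =>
    by_cases hvw : v = w
    · exact hvw ▸ base
    · have := D.length_path hvw; omega
  | succ n ih =>
    by_cases hvw : v = w
    · exact hvw ▸ base
    · exact step v hvw (ih _ (by have := D.length_path hvw; omega))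

/-- If `v` lies between `u` and `w`, then `w` is seen from `u` in the direction of `v`. -/
theorem dir_eq_of_between {u v w : V} (huv : u ≠ v) (h : D.dir v u ≠ D.dir v w) :
    D.dir u w = D.dir u v := by
  revert huv h
  refine D.path_induction v (P := fun u => u ≠ v → D.dir v u ≠ D.dir v w → D.dir u w = D.dir u v)
    (fun h => absurd rfl h) ?_ u
  intro u hu ih _ h
  by_cases h' : D.dir u v = v
  · rw [h']
    refine D.dir_of_dir_ne (h' ▸ D.adj_dir hu) fun h2 => h ?_
    rw [h2]
    exact D.dir_eq_of_adj (h' ▸ D.adj_dir hu).symm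
  · refine D.dir_of_dir_ne (D.adj_dir hu) ?_
    rw [ih h' (by rwa [D.dir_dir_eq hu.symm h'])]
    exact D.dir_dir hu

theorem val_of_dir {u v : V} (h : D.dir u v ≠ v) (huv : u ≠ v) : 3 ≤ D.val (D.dir u v) := by
  rcases D.val_eq (D.dir u v) with h1 | h1
  · exfalso
    obtain ⟨a, ha⟩ := Finset.card_eq_one.1 h1
    have h2 : D.dir (D.dir u v) v ∈ D.nbrs (D.dir u v) := D.dir_mem_nbrs h
    have h3 : u ∈ D.nbrs (D.dir u v) := D.mem_nbrs.2 (D.adj_dir huv).symm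
    rw [ha, Finset.mem_singleton] at h2 h3
    exact D.dir_dir huv (h2.trans h3.symm)
  · exact h1

/-! ### Linking numbers. -/

theorem weight_pos' {v u : V} (hv : 3 ≤ D.val v) (h : u ∈ D.nbrs v) : 0 < D.weight v u := by
  classical
  refine D.weight_pos v u ?_ (D.mem_nbrs.1 h)
  rw [val, nbrs, SimpleGraph.card_neighborFinset_eq_degree] at hv
  convert hv

theorem nodeWeight_pos {v : V} (hv : 3 ≤ D.val v) : 0 < D.nodeWeight v :=
  Finset.prod_pos fun _ hu => D.weight_pos' hv hu

theorem linking_self (v : V) : D.linking v v = D.nodeWeight v := by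
  classical
  simp [linking, path_self, nodeWeight]

/-- Moving the start of the path across the edge `vu` changes only the contributions of `v` and `u`.
The comparisons of linking numbers below iterate this one-step formula. -/
theorem linking_mul_weight {v u w : V} (hvu : D.graph.Adj v u) (h : D.dir v w = u) :
    D.linking v w * (D.weight v u * D.weight u v) = D.nodeWeight v * D.linking u w := by
  classical
  subst h
  have hvw : v ≠ w := by rintro rfl; exact hvu.ne (by rw [dir_self])
  set u := D.dir v w with hu
  have hn := D.notMem_support_path hvw
  have hp := D.path_eq_cons hvw
  have key : ∀ x y, s(x, y) ∈ (D.path v w).edges ↔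
      s(x, y) = s(v, u) ∨ s(x, y) ∈ (D.path u w).edges := fun x y => by
    rw [hp, SimpleGraph.Walk.edges_cons, List.mem_cons]
  have hv : (D.nbrs v).filter (fun y => s(v, y) ∉ (D.path v w).edges) = (D.nbrs v).erase u := by
    ext y
    rw [Finset.mem_filter, Finset.mem_erase, and_comm]
    refine and_congr_left fun hy => ?_
    rw [D.mem_edges_path (D.mem_nbrs.1 hy)]
    exact ne_comm
  have hsup : (D.path v w).support.toFinset = insert v (D.path u w).support.toFinset := by
    rw [hp, SimpleGraph.Walk.support_cons, List.toFinset_cons]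
  have hus : u ∈ (D.path u w).support.toFinset := by simp
  rw [linking, hsup, Finset.prod_insert (by simpa using hn), hv,
    ← Finset.mul_prod_erase _ _ hus, linking, ← Finset.mul_prod_erase _ _ hus]
  have hrest : ∏ x ∈ (D.path u w).support.toFinset.erase u,
      ∏ y ∈ (D.nbrs x).filter (fun y => s(x, y) ∉ (D.path v w).edges), D.weight x y =
      ∏ x ∈ (D.path u w).support.toFinset.erase u,
      ∏ y ∈ (D.nbrs x).filter (fun y => s(x, y) ∉ (D.path u w).edges), D.weight x y := by
    refine Finset.prod_congr rfl fun x hx => ?_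
    rw [Finset.mem_erase, List.mem_toFinset] at hx
    refine Finset.prod_congr (Finset.filter_congr fun y _ => not_congr ?_) fun _ _ => rfl
    rw [key, or_iff_right]
    intro h
    rcases Sym2.eq_iff.1 h with h | h
    · obtain ⟨rfl, -⟩ := h
      exact hn hx.2
    · exact hx.1 h.1
  have hu' : (D.nbrs u).filter (fun y => s(u, y) ∉ (D.path u w).edges) =
      insert v ((D.nbrs u).filter (fun y => s(u, y) ∉ (D.path v w).edges)) := by
    ext y
    rw [Finset.mem_insert, Finset.mem_filter, Finset.mem_filter, key]
    constructor
    · rintro ⟨h1, h2⟩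
      by_cases hyv : y = v
      · exact .inl hyv
      · refine .inr ⟨h1, ?_⟩
        rintro (h | h)
        · rcases Sym2.eq_iff.1 h with h | h
          · exact hvu.ne h.1.symm
          · exact hyv h.2
        · exact h2 h
    · rintro (rfl | ⟨h1, h2⟩)
      · refine ⟨D.mem_nbrs.2 hvu.symm, fun h => hn ?_⟩
        exact SimpleGraph.Walk.snd_mem_support_of_mem_edges _ h
      · exact ⟨h1, fun h => h2 (.inr h)⟩
  have hvn : v ∉ (D.nbrs u).filter (fun y => s(u, y) ∉ (D.path v w).edges) := by
    rw [Finset.mem_filter, key, Sym2.eq_swap]; simp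
  rw [hrest, hu', Finset.prod_insert hvn, nodeWeight, ← Finset.mul_prod_erase _ _ (D.mem_nbrs.2 hvu)]
  ring

theorem nodeWeight_mul_lt {v u : V} (hv : 3 ≤ D.val v) (hu : 3 ≤ D.val u)
    (hvu : D.graph.Adj v u) :
    D.nodeWeight v * D.nodeWeight u < (D.weight v u * D.weight u v) ^ 2 := by
  classical
  have h1 := D.edgeDet_pos v u (by
    rw [val, nbrs, SimpleGraph.card_neighborFinset_eq_degree] at hv; convert hv) (by
    rw [val, nbrs, SimpleGraph.card_neighborFinset_eq_degree] at hu; convert hu) hvu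
  have e1 : D.nodeWeight v = D.weight v u * ∏ x ∈ (D.nbrs v).erase u, D.weight v x :=
    (Finset.mul_prod_erase _ _ (D.mem_nbrs.2 hvu)).symm
  have e2 : D.nodeWeight u = D.weight u v * ∏ x ∈ (D.nbrs u).erase v, D.weight u x :=
    (Finset.mul_prod_erase _ _ (D.mem_nbrs.2 hvu.symm)).symm
  have h2 : (∏ x ∈ (D.nbrs v).erase u, D.weight v x) * ∏ x ∈ (D.nbrs u).erase v, D.weight u x
      < D.weight v u * D.weight u v := by
    convert h1 using 2 <;> · unfold nbrs; congr!
  have p1 := D.weight_pos' hv (D.mem_nbrs.2 hvu)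
  have p2 := D.weight_pos' hu (D.mem_nbrs.2 hvu.symm)
  rw [e1, e2]
  calc _ = (D.weight v u * D.weight u v) * ((∏ x ∈ (D.nbrs v).erase u, D.weight v x) *
        ∏ x ∈ (D.nbrs u).erase v, D.weight u x) := by ring
    _ < (D.weight v u * D.weight u v) * (D.weight v u * D.weight u v) :=
        Nat.mul_lt_mul_of_pos_left h2 (Nat.mul_pos p1 p2)
    _ = _ := by ring

theorem linking_pos {v : V} (hv : 3 ≤ D.val v) (w : V) : 0 < D.linking v w := by
  classical
  refine Finset.prod_pos fun x hx => Finset.prod_pos fun y hy => ?_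
  rw [Finset.mem_filter] at hy
  rw [List.mem_toFinset] at hx
  rcases D.val_eq x with h1 | h1
  · exfalso
    have hxv : x ≠ v := by rintro rfl; omega
    obtain ⟨a, ha⟩ := Finset.card_eq_one.1 h1
    have hd := D.dir_mem_nbrs hxv
    have hy1 := hy.1
    rw [ha, Finset.mem_singleton] at hd hy1
    rw [hy1, ← hd] at hy
    refine hy.2 (SimpleGraph.Walk.edges_takeUntil_subset_edges (D.path v w) hx ?_)
    rw [D.eq_path ((D.path_isPath v w).takeUntil hx), ← D.path_reverse x v,
      SimpleGraph.Walk.edges_reverse, List.mem_reverse]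
    exact (D.mem_edges_path (D.adj_dir hxv)).2 rfl
  · exact D.weight_pos' h1 hy.1

/-- Here `v` lies on the path from `u` to `w`, so each step towards `v` rescales `ℓ_{uw}` and
`ℓ_{uv}` by the same factor. -/
theorem linking_mul_eq {u v w : V} (hu : 3 ≤ D.val u) (hv : 3 ≤ D.val v)
    (h : u = v ∨ D.dir v u ≠ D.dir v w) :
    D.linking u w * D.nodeWeight v = D.linking u v * D.linking v w := by
  revert hu h
  refine D.path_induction v (P := fun u => 3 ≤ D.val u → (u = v ∨ D.dir v u ≠ D.dir v w) →
    D.linking u w * D.nodeWeight v = D.linking u v * D.linking v w)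
    (fun _ _ => by rw [D.linking_self, mul_comm]) ?_ u
  intro u huv ih hu h
  replace h := h.resolve_left huv
  have hadj := D.adj_dir huv
  have hd : D.dir u w = D.dir u v := D.dir_eq_of_between huv h
  have e1 := D.linking_mul_weight hadj hd
  have e2 := D.linking_mul_weight hadj rfl
  have hu' : 3 ≤ D.val (D.dir u v) := by
    by_cases h' : D.dir u v = v
    · rwa [h']
    · exact D.val_of_dir h' huv
  have ih := ih hu' (by
    by_cases h' : D.dir u v = v
    · exact .inl h'
    · exact .inr (by rwa [D.dir_dir_eq huv.symm h']))
  have p : 0 < D.weight u (D.dir u v) * D.weight (D.dir u v) u :=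
    Nat.mul_pos (D.weight_pos' hu (D.mem_nbrs.2 hadj)) (D.weight_pos' hu' (D.mem_nbrs.2 hadj.symm))
  refine Nat.eq_of_mul_eq_mul_right p ?_
  calc _ = D.nodeWeight u * (D.linking (D.dir u v) w * D.nodeWeight v) := by
        linear_combination D.nodeWeight v * e1
    _ = D.nodeWeight u * D.linking (D.dir u v) v * D.linking v w := by rw [ih]; ring
    _ = _ := by rw [← e2]; ring

/-- Walking from `u` to `v`, a step that also approaches `w` rescales both sides equally, while a
step away from `w` makes the inequality strict by the edge determinant condition. In the strict case
the walk must contain a step of the second kind. -/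
theorem linking_mul_le {u v w : V} (hu : 3 ≤ D.val u) (hv : 3 ≤ D.val v) :
    D.linking u v * D.linking v w ≤ D.linking u w * D.nodeWeight v ∧
    (u ≠ v → D.dir v u = D.dir v w →
      D.linking u v * D.linking v w < D.linking u w * D.nodeWeight v) := by
  revert hu
  refine D.path_induction v (P := fun u => 3 ≤ D.val u →
    D.linking u v * D.linking v w ≤ D.linking u w * D.nodeWeight v ∧
    (u ≠ v → D.dir v u = D.dir v w →
      D.linking u v * D.linking v w < D.linking u w * D.nodeWeight v))
    (fun _ => ⟨by rw [D.linking_self, mul_comm], fun h => absurd rfl h⟩) ?_ u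
  intro u huv ih hu
  have hadj := D.adj_dir huv
  have e2 := D.linking_mul_weight hadj rfl
  have hu' : 3 ≤ D.val (D.dir u v) := by
    by_cases h' : D.dir u v = v
    · rwa [h']
    · exact D.val_of_dir h' huv
  obtain ⟨ih1, ih2⟩ := ih hu'
  have p : 0 < D.weight u (D.dir u v) * D.weight (D.dir u v) u :=
    Nat.mul_pos (D.weight_pos' hu (D.mem_nbrs.2 hadj)) (D.weight_pos' hu' (D.mem_nbrs.2 hadj.symm))
  have pu := D.nodeWeight_pos hu
  have pu' := D.nodeWeight_pos hu'
  have pv := D.nodeWeight_pos hv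
  by_cases hd : D.dir u w = D.dir u v
  · have e1 := D.linking_mul_weight hadj hd
    constructor
    · refine le_of_mul_le_mul_right ?_ p
      calc _ = D.nodeWeight u * (D.linking (D.dir u v) v * D.linking v w) := by
            linear_combination D.linking v w * e2
        _ ≤ D.nodeWeight u * (D.linking (D.dir u v) w * D.nodeWeight v) := by gcongr
        _ = _ := Eq.symm (by linear_combination D.nodeWeight v * e1)
    · intro _ hvw
      -- Otherwise `v` would separate `u` from `w`, contrary to the assumption of the strict case.
      have h' : D.dir u v ≠ v := by
        intro h'
        rw [h'] at hd
        refine (D.dir_eq_iff (h' ▸ hadj)).1 hd ?_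
        rw [← hvw]
        exact D.dir_eq_of_adj (h' ▸ hadj).symm
      refine lt_of_mul_lt_mul_right ?_ p.le
      calc _ = D.nodeWeight u * (D.linking (D.dir u v) v * D.linking v w) := by
            linear_combination D.linking v w * e2
        _ < D.nodeWeight u * (D.linking (D.dir u v) w * D.nodeWeight v) :=
            Nat.mul_lt_mul_of_pos_left (ih2 h' (by rwa [D.dir_dir_eq huv.symm h'])) pu
        _ = _ := Eq.symm (by linear_combination D.nodeWeight v * e1)
  · have e1 : D.linking (D.dir u v) w * (D.weight u (D.dir u v) * D.weight (D.dir u v) u) =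
        D.nodeWeight (D.dir u v) * D.linking u w := by
      have := D.linking_mul_weight (w := w) hadj.symm (by
        by_contra h
        exact hd ((D.dir_eq_iff hadj).2 h))
      rw [← this]; ring
    have hdet := D.nodeWeight_mul_lt hu hu' hadj
    have pl := D.linking_pos hu w
    have hlt : D.linking u v * D.linking v w < D.linking u w * D.nodeWeight v := by
      set k := D.weight u (D.dir u v) * D.weight (D.dir u v) u with hk
      -- One factor `k` is used by `e1` and one by `e2`.
      refine lt_of_mul_lt_mul_right (a := k * k) ?_ (Nat.zero_le _)
      calc _ = D.nodeWeight u * (D.linking (D.dir u v) v * D.linking v w) * k := by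
            linear_combination D.linking v w * k * e2
        _ ≤ D.nodeWeight u * (D.linking (D.dir u v) w * D.nodeWeight v) * k := by gcongr
        _ = (D.nodeWeight u * D.nodeWeight (D.dir u v)) * (D.linking u w * D.nodeWeight v) := by
            linear_combination D.nodeWeight u * D.nodeWeight v * e1
        _ < k ^ 2 * (D.linking u w * D.nodeWeight v) :=
            Nat.mul_lt_mul_of_pos_right hdet (Nat.mul_pos pl pv)
        _ = _ := by ring
    exact ⟨hlt.le, fun _ _ => hlt⟩

end GenSpliceDiagram

/-! ### Linear systems with nonzero maximal minors. -/

section Generic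

variable {M : Type*} [AddCommGroup M] [Module ℂ M]

/-- The unknowns lie in a module because the lemma will be used in quotients of a valued field by a
complex subspace, where only scalars of `ℂ` act. -/
theorem eq_zero_of_det_ne_zero {m : ℕ} {B : Matrix (Fin m) (Fin m) ℂ} (hB : B.det ≠ 0)
    {z : Fin m → M} (hz : ∀ i, ∑ k, B i k • z k = 0) (k : Fin m) : z k = 0 := by
  have h1 : ∑ i, B⁻¹ k i • ∑ j, B i j • z j = 0 := by simp [hz]
  have h2 : ∀ j, ∑ i, B⁻¹ k i * B i j = (1 : Matrix (Fin m) (Fin m) ℂ) k j := fun j => by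
    rw [← Matrix.nonsing_inv_mul B (isUnit_iff_ne_zero.2 hB)]; rfl
  simp_rw [Finset.smul_sum, smul_smul] at h1
  rw [Finset.sum_comm] at h1
  simp_rw [← Finset.sum_smul, h2, Matrix.one_apply, ite_smul, one_smul, zero_smul] at h1
  simpa using h1

theorem exists_embedding_of_card_le {m : ℕ} {E : Type*} {s : Finset E} (hs : m ≤ s.card) :
    ∃ c : Fin m ↪ E, ∀ k, c k ∈ s := by
  obtain ⟨c⟩ : Nonempty (Fin m ↪ s) := Function.Embedding.nonempty_of_card_le (by simpa using hs)
  exact ⟨c.trans (Function.Embedding.subtype _), fun k => (c k).2⟩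

variable {m : ℕ} {E : Type*} [Fintype E] {A : Matrix (Fin m) E ℂ}

/-- The solution space of a generic homogeneous system is parametrized by any two coordinates. -/
theorem generic_eq_zero (hA : ∀ c : Fin m ↪ E, (A.submatrix id c).det ≠ 0)
    (hE : Fintype.card E = m + 2) {y : E → M} (hy : ∀ i, ∑ e, A i e • y e = 0) {e₁ e₂ : E}
    (hne : e₁ ≠ e₂) (h₁ : y e₁ = 0) (h₂ : y e₂ = 0) (e : E) : y e = 0 := by
  classical
  have hcard : (({e₁, e₂} : Finset E)ᶜ).card = m := by
    rw [Finset.card_compl, Finset.card_pair hne, hE]; omega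
  obtain ⟨c, hc⟩ := exists_embedding_of_card_le hcard.ge
  have himg : Finset.univ.map c = ({e₁, e₂} : Finset E)ᶜ :=
    Finset.eq_of_subset_of_card_le (fun x hx => by
      obtain ⟨k, -, rfl⟩ := Finset.mem_map.1 hx
      exact hc k) (by rw [hcard, Finset.card_map, Finset.card_univ, Fintype.card_fin])
  have hsum : ∀ i, ∑ k, (A.submatrix id c) i k • y (c k) = 0 := fun i => by
    have h := hy i
    rw [← Finset.sum_compl_add_sum {e₁, e₂}, Finset.sum_pair hne, h₁, h₂, ← himg,
      Finset.sum_map] at h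
    simpa using h
  by_cases h : e ∈ ({e₁, e₂} : Finset E)
  · rcases Finset.mem_insert.1 h with rfl | h
    · exact h₁
    · rw [Finset.mem_singleton.1 h, h₂]
  · rw [← Finset.mem_compl, ← himg] at h
    obtain ⟨k, -, rfl⟩ := Finset.mem_map.1 h
    exact eq_zero_of_det_ne_zero (z := fun k => y (c k)) (hA c) hsum k

/-- A row relation of a generic matrix that holds in all but one column is trivial. -/
theorem generic_row_eq_zero (hA : ∀ c : Fin m ↪ E, (A.submatrix id c).det ≠ 0)
    (hE : Fintype.card E = m + 2) {r : Fin m → M} (e₀ : E)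
    (hr : ∀ e, e ≠ e₀ → ∑ i, A i e • r i = 0) (i : Fin m) : r i = 0 := by
  classical
  obtain ⟨c, hc⟩ := exists_embedding_of_card_le (m := m) (s := ({e₀} : Finset E)ᶜ)
    (by rw [Finset.card_compl, Finset.card_singleton, hE]; omega)
  refine eq_zero_of_det_ne_zero (B := (A.submatrix id c).transpose)
    (by rw [Matrix.det_transpose]; exact hA c) (fun k => ?_) i
  exact hr (c k) (by simpa using hc k)

theorem exists_generic (m : ℕ) (E : Type*) [Fintype E] :
    ∃ A : Matrix (Fin m) E ℂ, ∀ c : Fin m ↪ E, (A.submatrix id c).det ≠ 0 := by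
  let t : E → ℂ := fun e => ((Fintype.equivFin E e : ℕ) : ℂ)
  have ht : Function.Injective t := fun a b h =>
    (Fintype.equivFin E).injective (Fin.ext (Nat.cast_injective h))
  refine ⟨fun i e => t e ^ (i : ℕ), fun c => ?_⟩
  have : Matrix.submatrix (fun (i : Fin m) (e : E) => t e ^ (i : ℕ)) id c =
      (Matrix.vandermonde (t ∘ c)).transpose := by
    ext i k; rfl
  rw [this, Matrix.det_transpose]
  exact Matrix.det_vandermonde_ne_zero_iff.2 (ht.comp c.injective)

end Generic

/-! ### Existence of the choices, and the number of equations. -/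

namespace GenSpliceDiagram

variable {V : Type*} [Fintype V] (D : GenSpliceDiagram V)

theorem nonempty_system (hD : D.SemigroupCondition) : Nonempty D.System := by
  choose m hm using hD
  choose A hA using fun v : D.Node => exists_generic (D.val v - 2) (D.nbrs v)
  exact ⟨⟨fun v u => m v u u.2, fun v u => hm v u u.2, A, hA, fun _ _ => 0, by simp⟩⟩

variable {D}

theorem Admissible.dir_eq {v u : V} {m : D.Leaf →₀ ℕ} (h : D.Admissible v u m) (hu : u ∈ D.nbrs v)
    {w : D.Leaf} (hw : m w ≠ 0) : D.dir v w = u :=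
  (D.mem_edges_path (D.mem_nbrs.1 hu)).1 (h.1 w (Finsupp.mem_support_iff.2 hw))

theorem Admissible.sum_eq {v u : V} {m : D.Leaf →₀ ℕ} (h : D.Admissible v u m) :
    ∑ w, m w * D.linking v w = D.nodeWeight v := by
  rw [← h.2, monomialWeight, Finsupp.sum_fintype]
  simp

theorem Admissible.exists_ne_zero {v u : V} {m : D.Leaf →₀ ℕ} (h : D.Admissible v u m)
    (hv : 3 ≤ D.val v) : ∃ w, m w ≠ 0 := by
  by_contra! h'
  have := h.sum_eq
  have := D.nodeWeight_pos hv
  simp_all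

theorem exists_leaf_dir_eq (hD : D.SemigroupCondition) {v u : V} (hv : 3 ≤ D.val v)
    (hu : u ∈ D.nbrs v) : ∃ w : D.Leaf, D.dir v w = u := by
  obtain ⟨m, hm⟩ := hD ⟨v, hv⟩ u hu
  obtain ⟨w, hw⟩ := hm.exists_ne_zero hv
  exact ⟨w, hm.dir_eq hu hw⟩

theorem System.semigroupCondition (S : D.System) : D.SemigroupCondition :=
  fun v u hu => ⟨S.expo v ⟨u, hu⟩, S.admissible v ⟨u, hu⟩⟩

variable (D)

/-- In a tree the valencies sum to twice the number of vertices minus $2$. Leaves contribute $1$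
each, so $\sum_v(\delta_v-2)=t-2$ over the nodes. -/
theorem card_equations :
    Nat.card (Σ v : D.Node, Fin (D.val v - 2)) + 2 = Nat.card D.Leaf := by
  classical
  have h1 : ∑ v, D.val v = 2 * (D.graph.edgeFinset).card := by
    rw [← D.graph.sum_degrees_eq_twice_card_edges]
    refine Finset.sum_congr rfl fun v _ => ?_
    rw [val, nbrs, ← SimpleGraph.card_neighborFinset_eq_degree]
  have h2 := D.isTree.card_edgeFinset
  have h3 : Fintype.card D.Leaf + Fintype.card D.Node = Fintype.card V := by
    rw [← Fintype.card_subtype_or_disjoint, ← Fintype.card_congr (Equiv.subtypeUnivEquiv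
      fun v => D.val_eq v)]
    rw [Pi.disjoint_iff]
    intro v
    simp only [Prop.disjoint_iff]
    omega
  have h4 : ∑ v, D.val v = ∑ v : D.Leaf, D.val v + ∑ v : D.Node, D.val v := by
    rw [← Fintype.sum_subtype_add_sum_subtype (fun v => D.val v = 1)]
    congr 1
    refine Fintype.sum_equiv (Equiv.subtypeEquivRight fun v => ?_) _ _ fun v => rfl
    have := D.val_eq v
    omega
  have h5 : ∑ v : D.Leaf, D.val v = Fintype.card D.Leaf := by
    rw [Finset.sum_congr rfl fun v _ => v.2]; simp
  have h6 : ∑ v : D.Node, D.val v = ∑ v : D.Node, (D.val v - 2) + 2 * Fintype.card D.Node := by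
    rw [mul_comm, ← smul_eq_mul, ← Finset.card_univ, ← Finset.sum_const, ← Finset.sum_add_distrib]
    refine Finset.sum_congr rfl fun v _ => ?_
    have := v.2
    omega
  rw [Nat.card_eq_fintype_card, Nat.card_eq_fintype_card, Fintype.card_sigma]
  simp only [Fintype.card_fin]
  omega

end GenSpliceDiagram

/-! ### Combinatorics of tight monomials. -/

namespace GenSpliceDiagram

variable {V : Type*} [Fintype V] {D : GenSpliceDiagram V}

theorem leaf_ne_node (w : D.Leaf) (v : D.Node) : (v : V) ≠ w := fun h => by
  have h1 := w.2
  have h2 := v.2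
  rw [h, h1] at h2
  omega

theorem exists_third_nbr {v : V} (hv : 3 ≤ D.val v) (a b : V) :
    ∃ e ∈ D.nbrs v, e ≠ a ∧ e ≠ b := by
  classical
  obtain ⟨e, he, h⟩ := Finset.exists_mem_notMem_of_card_lt_card
    (s := {a, b}) (t := D.nbrs v) (lt_of_le_of_lt Finset.card_le_two hv)
  exact ⟨e, he, by simpa [not_or] using h⟩

theorem eq_of_dir_eq_leaf {v e w : V} (h : e ∈ D.nbrs v) (he : D.val e = 1)
    (hw : D.dir v w = e) : w = e := by
  by_contra hne
  obtain ⟨a, ha⟩ := Finset.card_eq_one.1 he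
  have h1 := D.dir_mem_nbrs (Ne.symm hne)
  have h2 := D.mem_nbrs.2 (D.mem_nbrs.1 h).symm
  rw [ha, Finset.mem_singleton] at h1 h2
  exact (D.dir_eq_iff (D.mem_nbrs.1 h)).1 hw (h1.trans h2.symm)

theorem length_path_of_between {u v w : V} (h : u = v ∨ D.dir v u ≠ D.dir v w) :
    (D.path u w).length = (D.path u v).length + (D.path v w).length := by
  revert h
  refine D.path_induction v (P := fun u => (u = v ∨ D.dir v u ≠ D.dir v w) →
    (D.path u w).length = (D.path u v).length + (D.path v w).length) (fun _ => ?_) ?_ u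
  · simp [path_self]
  intro u huv ih h
  replace h := h.resolve_left huv
  have hd : D.dir u w = D.dir u v := D.dir_eq_of_between huv h
  have huw : u ≠ w := by
    rintro rfl; exact h rfl
  rw [D.length_path huv, D.length_path huw, hd, ih]
  · ring
  · by_cases h' : D.dir u v = v
    · exact .inl h'
    · exact .inr (by rwa [D.dir_dir_eq huv.symm h'])

/-- For every node `v` a set `W v` of leaves, together with the properties that the set of leaves
of minimal order relative to `v` has at a point of a splice type singularity. -/
structure TightSets (S : D.System) where
  W : D.Node → D.Leaf → Prop
  nonempty : ∀ v, ∃ w, W v w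
  iff_of_between : ∀ v u : D.Node, v ≠ u → ∀ w : D.Leaf, W v w → D.dir u w ≠ D.dir u v →
    ∀ w' : D.Leaf, W u w' ↔ W v w' ∧ D.dir u w' ≠ D.dir u v
  balanced : ∀ (v : D.Node) (e₁ e₂ : D.nbrs v), e₁ ≠ e₂ →
    ¬ (∀ w, S.expo v e₁ w ≠ 0 → W v w) → ¬ (∀ w, S.expo v e₂ w ≠ 0 → W v w) →
    ∀ e, ¬ ∀ w, S.expo v e w ≠ 0 → W v w

namespace TightSets

variable {S : D.System} (T : TightSets S)

/-- The monomial at the node `v` in the direction `e` only involves leaves of `W v`. -/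
def Tight (v : D.Node) (e : D.nbrs v) : Prop := ∀ w, S.expo v e w ≠ 0 → T.W v w

variable {T}

theorem Tight.exists_leaf {v : D.Node} {e : D.nbrs v} (h : T.Tight v e) :
    ∃ w, T.W v w ∧ D.dir v w = e := by
  obtain ⟨w, hw⟩ := (S.admissible v e).exists_ne_zero v.2
  exact ⟨w, h w hw, (S.admissible v e).dir_eq e.2 hw⟩

variable (T)

/-- Behind an edge `W v` contains all leaves or none. Induction on the number of leaves behind the
edge: at its far end `u` the direction of `w₁` is tight by induction and the direction back to `v`
is not, so `balanced` makes every other direction at `u` tight. -/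
theorem mem_of_dir_eq (v : D.Node) (e : D.nbrs v) {w₁ : D.Leaf} (h₁ : T.W v w₁)
    (hw₁ : D.dir v w₁ = e) {w : D.Leaf} (hw : D.dir v w = e) : T.W v w := by
  classical
  induction hn : (Finset.univ.filter fun w : D.Leaf => D.dir v w = e).card using
    Nat.strong_induction_on generalizing v w₁ w with
  | _ n ih =>
  rcases D.val_eq e with he | he
  · have h1 := eq_of_dir_eq_leaf e.2 he hw₁
    have h2 := eq_of_dir_eq_leaf e.2 he hw
    rwa [Subtype.ext (h2.trans h1.symm)]
  · have hadj : D.graph.Adj v e := D.mem_nbrs.1 e.2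
    let u : D.Node := ⟨e, he⟩
    have huv : v ≠ u := fun h => hadj.ne (congrArg Subtype.val h)
    have hback : D.dir u v = v := D.dir_eq_of_adj hadj.symm
    have hW := T.iff_of_between v u huv w₁ h₁ (by rw [hback]; exact (D.dir_eq_iff hadj).1 hw₁)
    have hlt : ∀ e' : D.nbrs u, (e' : V) ≠ v →
        (Finset.univ.filter fun w : D.Leaf => D.dir u w = e').card < n := by
      intro e' he'
      rw [← hn]
      refine Finset.card_lt_card ((Finset.ssubset_iff_of_subset fun w hw => ?_).2 ?_)
      · simp only [Finset.mem_filter, Finset.mem_univ, true_and] at hw ⊢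
        exact D.dir_of_dir_ne hadj (hw ▸ he')
      · obtain ⟨a, ha, hav, hae⟩ := exists_third_nbr u.2 v e'
        obtain ⟨w, hw⟩ := exists_leaf_dir_eq S.semigroupCondition u.2 ha
        refine ⟨w, ?_, ?_⟩
        · simp only [Finset.mem_filter, Finset.mem_univ, true_and]
          exact D.dir_of_dir_ne hadj (hw ▸ hav)
        · simp only [Finset.mem_filter, Finset.mem_univ, true_and]
          exact hw ▸ hae
    have hne : ∀ {w : D.Leaf}, D.dir v w = e → D.dir u w ≠ v := fun h => (D.dir_eq_iff hadj).1 h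
    have hmem : ∀ w : D.Leaf, D.dir u w ∈ D.nbrs u := fun w => D.dir_mem_nbrs (leaf_ne_node w u)
    have hw₁u : T.W u w₁ := (hW w₁).2 ⟨h₁, by rw [hback]; exact hne hw₁⟩
    have ht₁ : T.Tight u ⟨_, hmem w₁⟩ := fun w' hw' =>
      ih _ (hlt ⟨_, hmem w₁⟩ (hne hw₁)) u ⟨_, hmem w₁⟩ hw₁u rfl
        ((S.admissible u _).dir_eq (hmem w₁) hw') rfl
    -- By `iff_of_between` no leaf on the side of `v` lies in `W u`.
    have hnt : ¬ T.Tight u ⟨v, D.mem_nbrs.2 hadj.symm⟩ := fun h => by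
      obtain ⟨w', h', hd⟩ := h.exists_leaf
      exact ((hW w').1 h').2 (hd.trans hback.symm)
    have ht₂ : T.Tight u ⟨_, hmem w⟩ := by
      by_contra h
      exact T.balanced u _ _ (fun h => hne hw (congrArg Subtype.val h)) h hnt _ ht₁
    obtain ⟨w₃, h₃, hd₃⟩ := ht₂.exists_leaf
    exact ((hW w).1 (ih _ (hlt ⟨_, hmem w⟩ (hne hw)) u ⟨_, hmem w⟩ h₃ hd₃ rfl rfl)).1

theorem exists_tight (v : D.Node) : ∃ e, T.Tight v e := by
  obtain ⟨w, hw⟩ := T.nonempty v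
  have he := D.dir_mem_nbrs (leaf_ne_node w v)
  exact ⟨⟨_, he⟩, fun w' hw' => T.mem_of_dir_eq v ⟨_, he⟩ hw rfl
    ((S.admissible v ⟨_, he⟩).dir_eq he hw')⟩

theorem tight_or_tight (v : D.Node) {e₁ e₂ : D.nbrs v} (h : e₁ ≠ e₂) :
    T.Tight v e₁ ∨ T.Tight v e₂ := by
  by_contra! h'
  obtain ⟨e, he⟩ := T.exists_tight v
  exact T.balanced v e₁ e₂ h h'.1 h'.2 e he

/-- A node `u` with the largest `W u` works: a tight monomial at `v` pointing towards `u` would give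
`W u ⊆ W v`, and the inclusion is strict because `v` has another tight direction. -/
theorem exists_centre [Nonempty D.Node] :
    ∃ u : D.Node, ∀ (v : D.Node) (e : D.nbrs v), v ≠ u → D.dir v u = e → ¬ T.Tight v e := by
  classical
  obtain ⟨u, -, hu⟩ := Finset.exists_max_image (Finset.univ : Finset D.Node)
    (fun v => (Finset.univ.filter (T.W v)).card) Finset.univ_nonempty
  refine ⟨u, fun v e hvu he ht => (hu v (Finset.mem_univ _)).not_gt ?_⟩
  have hvu' : (v : V) ≠ u := fun h => hvu (Subtype.ext h)
  obtain ⟨w₀, hw₀, hd₀⟩ := ht.exists_leaf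
  obtain ⟨a, ha, hav, -⟩ := exists_third_nbr u.2 (D.dir u v) (D.dir u v)
  obtain ⟨w, hw⟩ := exists_leaf_dir_eq S.semigroupCondition u.2 ha
  have hdw : D.dir v w = e := by
    rw [← he]; exact D.dir_eq_of_between hvu' (by rw [hw]; exact hav.symm)
  have hW := T.iff_of_between v u hvu w (T.mem_of_dir_eq v e hw₀ hd₀ hdw) (by rwa [hw])
  refine Finset.card_lt_card ((Finset.ssubset_iff_of_subset fun w hw => ?_).2 ?_)
  · simp only [Finset.mem_filter, Finset.mem_univ, true_and] at hw ⊢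
    exact ((hW w).1 hw).1
  · obtain ⟨e₁, he₁, hne₁, -⟩ := exists_third_nbr v.2 e e
    obtain ⟨e₂, he₂, hne₂, h₁₂⟩ := exists_third_nbr v.2 e e₁
    have key : ∃ e', T.Tight v e' ∧ e' ≠ e := by
      rcases T.tight_or_tight v (e₁ := ⟨e₁, he₁⟩) (e₂ := ⟨e₂, he₂⟩)
        (fun h => h₁₂ (congrArg Subtype.val h).symm) with h | h
      · exact ⟨_, h, fun h => hne₁ (congrArg Subtype.val h)⟩
      · exact ⟨_, h, fun h => hne₂ (congrArg Subtype.val h)⟩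
    obtain ⟨e', ht', hne'⟩ := key
    obtain ⟨w₄, hw₄, hd₄⟩ := ht'.exists_leaf
    refine ⟨w₄, by simpa using hw₄, ?_⟩
    simp only [Finset.mem_filter, Finset.mem_univ, true_and]
    intro h
    refine ((hW w₄).1 h).2 (D.dir_eq_of_between hvu'.symm ?_)
    rw [he, hd₄]
    exact fun h => hne' (Subtype.ext h.symm)

end TightSets

/-! ### Linear independence of the exponent vectors. -/

/-- The exponent vectors of the admissible monomials pointing away from a node `u` satisfy no
relation other than those forced by homogeneity. -/
theorem eq_zero_of_sum_expo_smul {M : Type*} [AddCommGroup M] [Module ℂ M] (S : D.System)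
    (u : D.Node) (c : (v : D.Node) → D.nbrs v → M) (hsum : ∀ v, ∑ e, c v e = 0)
    (hdir : ∀ (v : D.Node) (e : D.nbrs v), v ≠ u → D.dir v u = e → c v e = 0)
    (hrel : ∀ w, ∑ v, ∑ e, S.expo v e w • c v e = 0) (v : D.Node) (e : D.nbrs v) : c v e = 0 := by
  classical
  induction hn : (D.path u v).length using Nat.strong_induction_on generalizing v with
  | _ n ih =>
  by_cases hvu : v ≠ u ∧ D.dir v u = e
  · exact hdir v e hvu.1 hvu.2
  -- The relation `hrel` is summed over the leaves behind `e` with weights `ℓ_{vw}`, which isolates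
  -- `c v e`. The induction runs outwards from `u`.
  let N : (v' : D.Node) → D.nbrs v' → ℕ := fun v' e' =>
    ∑ w ∈ Finset.univ.filter fun w : D.Leaf => D.dir v w = e, D.linking v w * S.expo v' e' w
  have htot : ∑ v', ∑ e', N v' e' • c v' e' = 0 := by
    have : ∑ w ∈ Finset.univ.filter fun w : D.Leaf => D.dir v w = e,
        D.linking v w • ∑ v', ∑ e', S.expo v' e' w • c v' e' = 0 :=
      Finset.sum_eq_zero fun w _ => by rw [hrel, smul_zero]
    rw [← this]
    simp only [N, Finset.smul_sum, Finset.sum_smul, smul_smul]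
    exact (Finset.sum_congr rfl fun v' _ => Finset.sum_comm).trans Finset.sum_comm
  -- If `v'` lies behind `e`, every monomial at `v'` not pointing towards `u` has the same
  -- coefficient `ℓ_{vv'}`, and `hsum` applies. Otherwise only the monomial pointing towards `v` can
  -- involve leaves behind `e`, and its coefficient vanishes by `hdir`, or by induction because `v'`
  -- is nearer to `u`.
  have hoth : ∀ v', v' ≠ v → ∑ e', N v' e' • c v' e' = 0 := by
    intro v' hv'
    have hvv' : (v' : V) ≠ v := fun h => hv' (Subtype.ext h)
    by_cases hd : D.dir v v' = e
    · have hv'u : v' ≠ u := by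
        rintro rfl; exact hvu ⟨hv'.symm, hd⟩
      have hdd : D.dir v' u = D.dir v' v := by
        by_cases h : v = u
        · rw [h]
        · exact D.dir_eq_of_between hvv' fun h' => hvu ⟨h, h' ▸ hd⟩
      have : ∀ e', N v' e' • c v' e' = D.linking v v' • c v' e' := by
        intro e'
        by_cases he' : D.dir v' u = e'
        · rw [hdir v' e' hv'u he', smul_zero, smul_zero]
        congr 1
        refine Nat.eq_of_mul_eq_mul_right (D.nodeWeight_pos v'.2) ?_
        have hbet : ∀ w, S.expo v' e' w ≠ 0 → D.dir v' v ≠ D.dir v' w := fun w hw h =>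
          he' (by rw [hdd, h]; exact (S.admissible v' e').dir_eq e'.2 hw)
        have h1 : N v' e' = ∑ w : D.Leaf, D.linking v w * S.expo v' e' w := by
          refine Finset.sum_filter_of_ne fun w _ hw => ?_
          rw [← hd]
          exact D.dir_eq_of_between hvv'.symm (hbet w (right_ne_zero_of_mul hw))
        rw [h1, Finset.sum_mul, ← (S.admissible v' e').sum_eq, Finset.mul_sum]
        refine Finset.sum_congr rfl fun w _ => ?_
        by_cases hw : S.expo v' e' w = 0
        · simp [hw]
        · have := D.linking_mul_eq (w := w) v.2 v'.2 (.inr (hbet w hw))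
          rw [(S.admissible v' e').sum_eq]
          linear_combination S.expo v' e' w * this
      rw [Finset.sum_congr rfl fun e' _ => this e', ← Finset.smul_sum, hsum, smul_zero]
    · refine Finset.sum_eq_zero fun e' _ => ?_
      by_cases he' : D.dir v' v = e'
      · by_cases h : v' ≠ u ∧ D.dir v' u = D.dir v' v
        · rw [hdir v' e' h.1 (h.2.trans he'), smul_zero]
        · have hlen := D.length_path_of_between (u := u) (v := v') (w := v) (by
            by_cases h' : v' = u
            · exact .inl (by rw [h'])
            · exact .inr fun h2 => h ⟨h', h2⟩)
          have := D.length_path hvv'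
          rw [ih _ (by omega) v' e' rfl, smul_zero]
      · have : N v' e' = 0 := by
          refine Finset.sum_eq_zero fun w hw => ?_
          by_contra h
          refine hd ?_
          rw [← (Finset.mem_filter.1 hw).2]
          refine (D.dir_eq_of_between hvv'.symm fun h' => he' ?_).symm
          rw [h']
          exact (S.admissible v' e').dir_eq e'.2 (right_ne_zero_of_mul h)
        rw [this, zero_smul]
  rw [Fintype.sum_eq_single v hoth, Fintype.sum_eq_single e fun e' he' => ?_] at htot
  · have h1 : N v e = D.nodeWeight v := by
      rw [← (S.admissible v e).sum_eq]
      refine (Finset.sum_filter_of_ne fun w _ hw => ?_).trans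
        (Finset.sum_congr rfl fun w _ => mul_comm _ _)
      exact (S.admissible v e).dir_eq e.2 (right_ne_zero_of_mul hw)
    rw [h1, ← Nat.cast_smul_eq_nsmul ℂ] at htot
    exact (smul_eq_zero.1 htot).resolve_left (Nat.cast_ne_zero.2 (D.nodeWeight_pos v.2).ne')
  · have : N v e' = 0 := by
      refine Finset.sum_eq_zero fun w hw => ?_
      by_contra h
      refine he' (Subtype.ext ?_)
      rw [← (Finset.mem_filter.1 hw).2]
      exact ((S.admissible v e').dir_eq e'.2 (right_ne_zero_of_mul h)).symm
    rw [this, zero_smul]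

end GenSpliceDiagram

/-! ### Comparing orders of coordinates with weight vectors. -/

namespace GenSpliceDiagram

variable {V : Type*} [Fintype V] {D : GenSpliceDiagram V}
variable {Γ₀ : Type*} [LinearOrderedCommGroupWithZero Γ₀]

/-- For each node `v`, the largest multiple `μ v` of the weight vector of `v` that bounds the
orders `a`, written multiplicatively and after raising `a` to a power that makes it exist. -/
structure MaximalMultiple (a : D.Leaf → Γ₀) where
  power : ℕ
  power_ne_zero : power ≠ 0
  μ : D.Node → Γ₀
  μ_pos : ∀ v, 0 < μ v
  μ_lt_one : ∀ v, μ v < 1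
  le : ∀ (v : D.Node) (w : D.Leaf), a w ^ power ≤ μ v ^ D.linking v w
  attained : ∀ v : D.Node, ∃ w : D.Leaf, a w ^ power = μ v ^ D.linking v w

/-- The value group need not have roots. Raising to a power `G` divisible by all linking numbers
makes each root `a w ^ (G / ℓ)` available, and `μ v` is the largest of these. -/
theorem nonempty_maximalMultiple {a : D.Leaf → Γ₀} (ha₁ : ∀ w, a w < 1) (ha₀ : ∃ w, a w ≠ 0) :
    Nonempty (MaximalMultiple a) := by
  classical
  let G : ℕ := ∏ v : D.Node, ∏ w : D.Leaf, D.linking v w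
  have hG : 0 < G := Finset.prod_pos fun v _ => Finset.prod_pos fun w _ => D.linking_pos v.2 w
  have hdvd : ∀ (v : D.Node) (w : D.Leaf), D.linking v w ∣ G := fun v w =>
    (Finset.dvd_prod_of_mem (fun w : D.Leaf => D.linking v w) (Finset.mem_univ w)).trans
      (Finset.dvd_prod_of_mem (fun v : D.Node => ∏ w : D.Leaf, D.linking v w) (Finset.mem_univ v))
  have hpow : ∀ (v : D.Node) (w : D.Leaf), a w ^ G = (a w ^ (G / D.linking v w)) ^ D.linking v w :=
    fun v w => by rw [← pow_mul, Nat.div_mul_cancel (hdvd v w)]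
  have hne : ∀ (v : D.Node) (w : D.Leaf), G / D.linking v w ≠ 0 := fun v w =>
    (Nat.div_pos (Nat.le_of_dvd hG (hdvd v w)) (D.linking_pos v.2 w)).ne'
  obtain ⟨w₀, hw₀⟩ := ha₀
  choose m hm using fun v : D.Node => Finset.exists_max_image (Finset.univ : Finset D.Leaf)
    (fun w => a w ^ (G / D.linking v w)) ⟨w₀, Finset.mem_univ _⟩
  refine ⟨⟨G, hG.ne', fun v => a (m v) ^ (G / D.linking v (m v)), fun v => ?_, fun v => ?_,
    fun v w => ?_, fun v => ⟨m v, hpow v _⟩⟩⟩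
  · exact lt_of_lt_of_le (pow_pos (zero_lt_iff.2 hw₀) _) ((hm v).2 w₀ (Finset.mem_univ _))
  · exact pow_lt_one₀ zero_le (ha₁ _) (hne v _)
  · rw [hpow v]
    exact pow_le_pow_left₀ zero_le ((hm v).2 w (Finset.mem_univ _)) _

namespace MaximalMultiple

variable {a : D.Leaf → Γ₀} (P : MaximalMultiple a)

/-- The leaves whose order is minimal relative to the node `v`. -/
def W (v : D.Node) (w : D.Leaf) : Prop := a w ^ P.power = P.μ v ^ D.linking v w

/-- The leaf `w` beyond `u` forces `μ u ^ d_u = μ v ^ ℓ_{vu}`. After this, `linking_mul_eq`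
identifies the two conditions for leaves beyond `u`, and the strict part of `linking_mul_le`
excludes the leaves on the side of `v` from `W u`. -/
theorem W_iff_of_between {v u : D.Node} (hvu : v ≠ u) {w : D.Leaf} (hw : P.W v w)
    (hd : D.dir u w ≠ D.dir u v) (w' : D.Leaf) :
    P.W u w' ↔ P.W v w' ∧ D.dir u w' ≠ D.dir u v := by
  have hvu' : (v : V) ≠ u := fun h => hvu (Subtype.ext h)
  have hdu := (D.nodeWeight_pos u.2).ne'
  have hpow : ∀ w : D.Leaf, (a w ^ P.power) ^ D.nodeWeight u ≤
      P.μ v ^ (D.linking v w * D.nodeWeight u) := fun w => by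
    rw [pow_mul]; exact pow_le_pow_left₀ zero_le (P.le v w) _
  have hμ : P.μ u ^ D.nodeWeight u = P.μ v ^ D.linking v u := by
    apply le_antisymm
    · obtain ⟨w₁, hw₁⟩ := P.attained u
      refine (pow_le_pow_iff_left₀ zero_le zero_le (D.linking_pos u.2 w₁).ne').1 ?_
      calc _ = (a w₁ ^ P.power) ^ D.nodeWeight u := by rw [hw₁, ← pow_mul, ← pow_mul, mul_comm]
        _ ≤ P.μ v ^ (D.linking v w₁ * D.nodeWeight u) := hpow w₁
        _ ≤ P.μ v ^ (D.linking v u * D.linking u w₁) :=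
            pow_le_pow_of_le_one zero_le (P.μ_lt_one v).le (D.linking_mul_le v.2 u.2).1
        _ = _ := pow_mul _ _ _
    · refine (pow_le_pow_iff_left₀ zero_le zero_le (D.linking_pos u.2 w).ne').1 ?_
      calc _ = (a w ^ P.power) ^ D.nodeWeight u := by
            rw [hw, ← pow_mul, ← pow_mul, ← D.linking_mul_eq v.2 u.2 (.inr hd.symm)]
        _ ≤ (P.μ u ^ D.linking u w) ^ D.nodeWeight u := pow_le_pow_left₀ zero_le (P.le u w) _
        _ = _ := by rw [← pow_mul, ← pow_mul, mul_comm]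
  have hiff : P.W u w' ↔
      (a w' ^ P.power) ^ D.nodeWeight u = P.μ v ^ (D.linking v u * D.linking u w') := by
    rw [W, ← pow_left_inj₀ zero_le zero_le hdu, ← pow_mul (P.μ u), mul_comm (D.linking u w'),
      pow_mul (P.μ u), hμ, ← pow_mul (P.μ v)]
  rw [hiff]
  by_cases h : D.dir u w' = D.dir u v
  · refine iff_of_false (fun h' => ?_) fun h' => h'.2 h
    refine ((hpow w').trans_lt ?_).ne h'
    exact pow_lt_pow_right_of_lt_one₀ (P.μ_pos v) (P.μ_lt_one v)
      ((D.linking_mul_le v.2 u.2).2 hvu' h.symm)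
  · rw [← D.linking_mul_eq v.2 u.2 (.inr (Ne.symm h)), pow_mul (P.μ v),
      pow_left_inj₀ zero_le zero_le hdu]
    exact (and_iff_left h).symm

theorem prod_pow_le (v : D.Node) (m : D.Leaf →₀ ℕ) :
    (∏ w, a w ^ m w) ^ P.power ≤ P.μ v ^ D.monomialWeight v m := by
  rw [← Finset.prod_pow, monomialWeight, Finsupp.sum_fintype _ _ (by simp),
    ← Finset.prod_pow_eq_pow_sum]
  refine Finset.prod_le_prod (fun _ _ => zero_le) fun w _ => ?_
  rw [pow_right_comm, mul_comm (m w), pow_mul]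
  exact pow_le_pow_left₀ zero_le (P.le v w) _

theorem prod_pow_eq_iff (v : D.Node) (m : D.Leaf →₀ ℕ) :
    (∏ w, a w ^ m w) ^ P.power = P.μ v ^ D.monomialWeight v m ↔ ∀ w, m w ≠ 0 → P.W v w := by
  classical
  have hr : P.μ v ^ D.monomialWeight v m = ∏ w : D.Leaf, (P.μ v ^ D.linking v w) ^ m w := by
    rw [monomialWeight, Finsupp.sum_fintype _ _ (by simp), ← Finset.prod_pow_eq_pow_sum]
    exact Finset.prod_congr rfl fun w _ => by rw [mul_comm, pow_mul]
  have hl : (∏ w, a w ^ m w) ^ P.power = ∏ w, (a w ^ P.power) ^ m w := by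
    rw [← Finset.prod_pow]
    exact Finset.prod_congr rfl fun w _ => pow_right_comm _ _ _
  rw [hl, hr]
  constructor
  · intro h w hw
    by_contra hne
    refine h.not_lt ?_
    rw [← Finset.mul_prod_erase _ _ (Finset.mem_univ w),
      ← Finset.mul_prod_erase _ _ (Finset.mem_univ w)]
    calc _ ≤ (a w ^ P.power) ^ m w *
          ∏ w' ∈ Finset.univ.erase w, (P.μ v ^ D.linking v w') ^ m w' :=
          mul_le_mul_right (Finset.prod_le_prod (fun _ _ => zero_le) fun w' _ =>
            pow_le_pow_left₀ zero_le (P.le v w') _) _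
      _ < _ := mul_lt_mul_of_pos_right
          (pow_lt_pow_left₀ (lt_of_le_of_ne (P.le v w) hne) zero_le hw)
          (Finset.prod_pos fun w' _ => pow_pos (pow_pos (P.μ_pos v) _) _)
  · intro h
    refine Finset.prod_congr rfl fun w _ => ?_
    by_cases hw : m w = 0
    · rw [hw, pow_zero, pow_zero]
    · rw [show a w ^ P.power = _ from h w hw]

end MaximalMultiple

section Valuation

variable {K : Type*} [Field K] [Algebra ℂ K] (ν : Valuation K Γ₀)

/-- The elements of small valuation, as a complex vector space. -/
def ltSubmodule (hC : ∀ c : ℂ, ν (algebraMap ℂ K c) ≤ 1) (n : ℕ) {γ : Γ₀} (hn : n ≠ 0)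
    (hγ : 0 < γ) : Submodule ℂ K where
  carrier := {y | ν y ^ n < γ}
  zero_mem' := by simpa [hn] using hγ
  add_mem' {a b} ha hb := by
    refine (pow_le_pow_left₀ zero_le (ν.map_add a b) n).trans_lt ?_
    rcases max_choice (ν a) (ν b) with h | h <;> rw [h]
    exacts [ha, hb]
  smul_mem' c a ha := by
    refine (pow_le_pow_left₀ zero_le ?_ n).trans_lt ha
    rw [Algebra.smul_def, map_mul]
    exact mul_le_of_le_one_left zero_le (hC c)

variable {ν}

theorem valuation_aeval_monomial_le (hC : ∀ c : ℂ, ν (algebraMap ℂ K c) ≤ 1) (x : D.Leaf → K)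
    (m : D.Leaf →₀ ℕ) (c : ℂ) :
    ν (MvPolynomial.aeval x (MvPolynomial.monomial m c)) ≤ ∏ w, ν (x w) ^ m w := by
  rw [MvPolynomial.aeval_monomial, map_mul, Finsupp.prod_fintype _ _ (by simp), map_prod]
  simp only [map_pow]
  exact mul_le_of_le_one_left zero_le (hC c)

/-- The operator `x_w ∂/∂x_w` multiplies each monomial by an integer, so it preserves bounds on the
monomials. -/
theorem valuation_mul_aeval_pderiv_lt (hC : ∀ c : ℂ, ν (algebraMap ℂ K c) ≤ 1) {x : D.Leaf → K}
    {H : MvPolynomial D.Leaf ℂ} {γ : Γ₀} (hγ : 0 < γ)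
    (hH : ∀ m ∈ H.support, ∏ w, ν (x w) ^ m w < γ) (w : D.Leaf) :
    ν (x w * MvPolynomial.aeval x (MvPolynomial.pderiv w H)) < γ := by
  have : x w * MvPolynomial.aeval x (MvPolynomial.pderiv w H) =
      MvPolynomial.aeval x (MvPolynomial.X w * MvPolynomial.pderiv w H) := by simp
  rw [this, H.as_sum, map_sum, Finset.mul_sum, map_sum]
  refine ν.map_sum_lt' hγ fun m hm => ?_
  rw [MvPolynomial.X_mul_pderiv_monomial, ← map_nsmul]
  exact (valuation_aeval_monomial_le hC x m _).trans_lt (hH m hm)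

end Valuation

end GenSpliceDiagram

/-! ### Points with values in a valued field. -/

namespace GenSpliceDiagram

variable {V : Type*} [Fintype V] {D : GenSpliceDiagram V}
variable {Γ₀ : Type*} [LinearOrderedCommGroupWithZero Γ₀]
variable {K : Type*} [Field K] {ν : Valuation K Γ₀} {S : D.System} {x : D.Leaf → K}

theorem aeval_equation [Algebra ℂ K] (S : D.System) (x : D.Leaf → K) (v : D.Node)
    (i : Fin (D.val v - 2)) :
    MvPolynomial.aeval x (S.equation ⟨v, i⟩) =
      ∑ e, S.coeff v i e • ∏ w, x w ^ S.expo v e w + MvPolynomial.aeval x (S.higher v i) := by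
  rw [System.equation, map_add, map_sum]
  congr 1
  refine Finset.sum_congr rfl fun e _ => ?_
  rw [MvPolynomial.aeval_monomial, Finsupp.prod_fintype _ _ (by simp), Algebra.smul_def]

theorem mul_aeval_pderiv_equation [Algebra ℂ K] (S : D.System) (x : D.Leaf → K) (v : D.Node)
    (i : Fin (D.val v - 2)) (w : D.Leaf) :
    x w * MvPolynomial.aeval x (MvPolynomial.pderiv w (S.equation ⟨v, i⟩)) =
      ∑ e, S.coeff v i e • S.expo v e w • ∏ w, x w ^ S.expo v e w +
        x w * MvPolynomial.aeval x (MvPolynomial.pderiv w (S.higher v i)) := by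
  have hX : x w = MvPolynomial.aeval x (MvPolynomial.X w : MvPolynomial D.Leaf ℂ) := by simp
  rw [System.equation, map_add, map_sum, map_add, mul_add, map_sum, Finset.mul_sum]
  congr 1
  refine Finset.sum_congr rfl fun e _ => ?_
  conv_lhs => rw [hX]
  rw [← map_mul, MvPolynomial.X_mul_pderiv_monomial, map_nsmul, MvPolynomial.aeval_monomial,
    Finsupp.prod_fintype _ _ (by simp), ← Algebra.smul_def, smul_comm]

theorem card_nbrs (v : D.Node) : Fintype.card (D.nbrs v) = (D.val v - 2) + 2 := by
  have := v.2
  rw [Fintype.card_coe]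
  change D.val v = _
  omega

namespace MaximalMultiple

variable (P : MaximalMultiple fun w => ν (x w))

theorem tight_iff (v : D.Node) (e : D.nbrs v) :
    (∀ w, S.expo v e w ≠ 0 → P.W v w) ↔
      ν (∏ w, x w ^ S.expo v e w) ^ P.power = P.μ v ^ D.nodeWeight v := by
  rw [← P.prod_pow_eq_iff, (S.admissible v e).2, map_prod]
  simp only [map_pow]

theorem not_tight_iff (v : D.Node) (e : D.nbrs v) :
    (¬ ∀ w, S.expo v e w ≠ 0 → P.W v w) ↔
      ν (∏ w, x w ^ S.expo v e w) ^ P.power < P.μ v ^ D.nodeWeight v := by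
  have h := P.prod_pow_le v (S.expo v e)
  rw [(S.admissible v e).2] at h
  rw [P.tight_iff, map_prod, lt_iff_le_and_ne]
  simp only [map_pow]
  exact (and_iff_right h).symm

theorem higher_lt (S : D.System) (v : D.Node) (i : Fin (D.val v - 2)) {m : D.Leaf →₀ ℕ}
    (hm : m ∈ (S.higher v i).support) :
    (∏ w, ν (x w) ^ m w) ^ P.power < P.μ v ^ D.nodeWeight v :=
  (P.prod_pow_le v m).trans_lt
    (pow_lt_pow_right_of_lt_one₀ (P.μ_pos v) (P.μ_lt_one v) (S.higher_weight v i m hm))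

theorem aeval_higher_lt [Algebra ℂ K] (hC : ∀ c : ℂ, ν (algebraMap ℂ K c) ≤ 1)
    (S : D.System) (v : D.Node) (i : Fin (D.val v - 2)) :
    ν (MvPolynomial.aeval x (S.higher v i)) ^ P.power < P.μ v ^ D.nodeWeight v := by
  have hpos : 0 < P.μ v ^ D.nodeWeight v := pow_pos (P.μ_pos v) _
  have := Submodule.sum_mem (ltSubmodule ν hC P.power P.power_ne_zero hpos)
    (t := (S.higher v i).support)
    (f := fun m => MvPolynomial.aeval x (MvPolynomial.monomial m ((S.higher v i).coeff m)))
    fun m hm => (pow_le_pow_left₀ zero_le (valuation_aeval_monomial_le hC x m _) _).trans_lt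
      (P.higher_lt S v i hm)
  rw [← map_sum, ← (S.higher v i).as_sum] at this
  exact this

/-- The sets of leaves of minimal order at a point of a splice type singularity with values in a
valued field. -/
def tightSets [Algebra ℂ K] (hC : ∀ c : ℂ, ν (algebraMap ℂ K c) ≤ 1)
    (hf : ∀ j, MvPolynomial.aeval x (S.equation j) = 0) : TightSets S where
  W := P.W
  nonempty := P.attained
  iff_of_between _ _ hvu _ hw hd w' := P.W_iff_of_between hvu hw hd w'
  balanced v e₁ e₂ hne h₁ h₂ e := by
    simp only [not_tight_iff] at h₁ h₂ ⊢
    have hpos : 0 < P.μ v ^ D.nodeWeight v := pow_pos (P.μ_pos v) _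
    -- Modulo `Λ` the higher terms vanish, and what remains is a generic linear system whose zero
    -- unknowns are exactly the monomials that are not tight.
    let Λ := ltSubmodule ν hC P.power P.power_ne_zero hpos
    have hΛ : ∀ y, Λ.mkQ y = 0 ↔ ν y ^ P.power < P.μ v ^ D.nodeWeight v := fun y => by
      rw [Submodule.mkQ_apply, Submodule.Quotient.mk_eq_zero]; rfl
    rw [← hΛ] at h₁ h₂ ⊢
    refine generic_eq_zero (y := fun e => Λ.mkQ (∏ w, x w ^ S.expo v e w)) (S.generic v)
      (card_nbrs v) (fun i => ?_) hne h₁ h₂ e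
    have h := hf ⟨v, i⟩
    rw [aeval_equation] at h
    have h' := congrArg Λ.mkQ h
    rw [map_add, map_sum, (hΛ _).2 (P.aeval_higher_lt hC S v i), add_zero, map_zero] at h'
    simpa only [map_smul] using h'

end MaximalMultiple

theorem prod_ne_zero_or [Algebra ℂ K] (hC : ∀ c : ℂ, ν (algebraMap ℂ K c) ≤ 1)
    (hx₁ : ∀ w, ν (x w) < 1) (hx₀ : ∃ w, x w ≠ 0) (hf : ∀ j, MvPolynomial.aeval x (S.equation j) = 0) (v : D.Node)
    {e₁ e₂ : D.nbrs v} (hne : e₁ ≠ e₂) :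
    ∏ w, x w ^ S.expo v e₁ w ≠ 0 ∨ ∏ w, x w ^ S.expo v e₂ w ≠ 0 := by
  obtain ⟨P⟩ := nonempty_maximalMultiple (a := fun w => ν (x w)) hx₁
    (hx₀.imp fun w h => (Valuation.ne_zero_iff ν).2 h)
  have key : ∀ e, (P.tightSets hC hf).Tight v e → ∏ w, x w ^ S.expo v e w ≠ 0 := by
    intro e he h0
    have := (P.tight_iff v e).1 he
    rw [h0, map_zero, zero_pow P.power_ne_zero] at this
    exact (pow_pos (P.μ_pos v) _).ne this
  exact ((P.tightSets hC hf).tight_or_tight v hne).imp (key _) (key _)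

/-- Only the leading part of a relation between the rows is kept, namely its class modulo elements
smaller than the largest term. The combinatorial lemmas show that this class is zero. -/
theorem jacobian_rows_independent [Algebra ℂ K] (hC : ∀ c : ℂ, ν (algebraMap ℂ K c) ≤ 1)
    (hx₁ : ∀ w, ν (x w) < 1) (hx₀ : ∃ w, x w ≠ 0)
    (hf : ∀ j, MvPolynomial.aeval x (S.equation j) = 0)
    {r : (Σ v : D.Node, Fin (D.val v - 2)) → K}
    (hr : ∀ w, ∑ j, r j * MvPolynomial.aeval x (MvPolynomial.pderiv w (S.equation j)) = 0) :
    r = 0 := by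
  classical
  obtain ⟨P⟩ := nonempty_maximalMultiple (a := fun w => ν (x w)) hx₁
    (hx₀.imp fun w h => (Valuation.ne_zero_iff ν).2 h)
  let T := P.tightSets hC hf
  by_contra hr0
  obtain ⟨j₀, hj₀⟩ := Function.ne_iff.1 hr0
  choose t ht using T.exists_tight
  let mon : (v : D.Node) → D.nbrs v → K := fun v e => ∏ w, x w ^ S.expo v e w
  let s : D.Node → K := fun v => mon v (t v)
  have hmt : ∀ v e, T.Tight v e → ν (mon v e) = ν (s v) := fun v e he =>
    (pow_left_inj₀ zero_le zero_le P.power_ne_zero).1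
      (((P.tight_iff v e).1 he).trans ((P.tight_iff v (t v)).1 (ht v)).symm)
  have hlt : ∀ v y, ν y ^ P.power < P.μ v ^ D.nodeWeight v → ν y < ν (s v) := fun v y hy =>
    (pow_lt_pow_iff_left₀ zero_le zero_le P.power_ne_zero).1
      (hy.trans_eq ((P.tight_iff v (t v)).1 (ht v)).symm)
  have hmn : ∀ v e, ¬ T.Tight v e → ν (mon v e) < ν (s v) := fun v e he =>
    hlt v _ ((P.not_tight_iff v e).1 he)
  have hs : ∀ v, s v ≠ 0 := fun v h0 => by
    have := (P.tight_iff v (t v)).1 (ht v)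
    rw [show ∏ w, x w ^ S.expo v (t v) w = 0 from h0, map_zero, zero_pow P.power_ne_zero] at this
    exact (pow_pos (P.μ_pos v) _).ne this
  have hνs : ∀ v, 0 < ν (s v) := fun v => (Valuation.pos_iff ν).2 (hs v)
  -- Row `j` is measured in units of `s j.1`, the common size of the tight monomials at its node.
  obtain ⟨j₁, -, hj₁⟩ := Finset.exists_max_image Finset.univ
    (fun j : Σ v : D.Node, Fin (D.val v - 2) => ν (r j * s j.1)) ⟨j₀, Finset.mem_univ _⟩
  set ρ := ν (r j₁ * s j₁.1) with hρ
  have hρ0 : 0 < ρ := ((Valuation.pos_iff ν).2 (mul_ne_zero hj₀ (hs _))).trans_le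
    (hj₁ j₀ (Finset.mem_univ _))
  let Λ := ltSubmodule ν hC 1 one_ne_zero hρ0
  have hΛ : ∀ y, Λ.mkQ y = 0 ↔ ν y < ρ := fun y => by
    rw [Submodule.mkQ_apply, Submodule.Quotient.mk_eq_zero, ← pow_one (ν y)]; rfl
  have hsmall : ∀ (v : D.Node) (i : Fin (D.val v - 2)) (y : K), ν y < ν (s v) →
      Λ.mkQ (r ⟨v, i⟩ * y) = 0 := by
    intro v i y hy
    rw [hΛ]
    have h1 := hj₁ ⟨v, i⟩ (Finset.mem_univ _)
    by_cases h0 : r ⟨v, i⟩ = 0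
    · simpa [h0] using hρ0
    · refine lt_of_lt_of_le ?_ h1
      rw [map_mul, map_mul]
      exact mul_lt_mul_of_pos_left hy ((Valuation.pos_iff ν).2 h0)
  -- These are the leading coefficients of the monomials in the relation. They sum to zero at each
  -- node by the equations, and satisfy the exponent relation by the derivatives.
  let c : (v : D.Node) → D.nbrs v → K ⧸ Λ := fun v e =>
    ∑ i, S.coeff v i e • Λ.mkQ (r ⟨v, i⟩ * mon v e)
  have hcn : ∀ v e, ¬ T.Tight v e → c v e = 0 := fun v e he =>
    Finset.sum_eq_zero fun i _ => by rw [hsmall v i _ (hmn v e he), smul_zero]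
  have hsum : ∀ v, ∑ e, c v e = 0 := by
    intro v
    rw [Finset.sum_comm]
    refine Finset.sum_eq_zero fun i _ => ?_
    have h := congrArg (fun y => Λ.mkQ (r ⟨v, i⟩ * y)) (hf ⟨v, i⟩)
    simp only [aeval_equation, mul_add, map_add, mul_zero, map_zero] at h
    rw [hsmall v i _ (hlt v _ (P.aeval_higher_lt hC S v i)), add_zero, Finset.mul_sum,
      map_sum] at h
    rw [← h]
    refine Finset.sum_congr rfl fun e _ => ?_
    rw [mul_smul_comm, map_smul]
  have hrel : ∀ w, ∑ v, ∑ e, S.expo v e w • c v e = 0 := by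
    intro w
    -- Multiplying by `x w` turns the derivative of a monomial into its exponent times the monomial.
    have h := congrArg (fun y => Λ.mkQ (x w * y)) (hr w)
    simp only [mul_zero, map_zero, Finset.mul_sum, map_sum, mul_left_comm (x w)] at h
    rw [Fintype.sum_sigma] at h
    rw [← h]
    refine Finset.sum_congr rfl fun v _ => ?_
    simp only [c, Finset.smul_sum]
    rw [Finset.sum_comm]
    refine Finset.sum_congr rfl fun i _ => ?_
    rw [mul_aeval_pderiv_equation, mul_add, map_add, hsmall v i _
      (valuation_mul_aeval_pderiv_lt hC (hνs v) (fun m hm => ?_) w), add_zero, Finset.mul_sum,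
      map_sum]
    · refine Finset.sum_congr rfl fun e _ => ?_
      rw [mul_smul_comm, mul_smul_comm, map_smul, map_nsmul, smul_comm]
    · exact (pow_lt_pow_iff_left₀ zero_le zero_le P.power_ne_zero).1
        ((P.higher_lt S v i hm).trans_eq ((P.tight_iff v (t v)).1 (ht v)).symm)
  have : Nonempty D.Node := ⟨j₁.1⟩
  obtain ⟨u, hu⟩ := T.exists_centre
  have hc := eq_zero_of_sum_expo_smul S u c hsum (fun v e hvu he => hcn v e (hu v e hvu he)) hrel
  have hrow : ∃ e₀, ∀ e, e ≠ e₀ → T.Tight j₁.1 e := by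
    by_cases h : ∃ e₀, ¬ T.Tight j₁.1 e₀
    · obtain ⟨e₀, h₀⟩ := h
      exact ⟨e₀, fun e he => (T.tight_or_tight _ he).resolve_right h₀⟩
    · push Not at h
      exact ⟨t j₁.1, fun e _ => h e⟩
  obtain ⟨e₀, he₀⟩ := hrow
  refine ((hΛ (r j₁ * s j₁.1)).1 ?_).ne hρ
  refine generic_row_eq_zero (r := fun i => Λ.mkQ (r ⟨j₁.1, i⟩ * s j₁.1)) (S.generic j₁.1)
    (card_nbrs j₁.1) e₀ (fun e he => ?_) j₁.2
  have h1 := hc j₁.1 e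
  have hme : mon j₁.1 e ≠ 0 := by
    rw [← Valuation.pos_iff ν, hmt _ _ (he₀ e he)]; exact hνs _
  simp only [c, ← map_smul, ← map_sum] at h1 ⊢
  rw [hΛ] at h1 ⊢
  -- For tight `e` the quotient `s j₁.1 / mon j₁.1 e` has valuation one, so `s` may replace the
  -- monomial. This covers all columns but one, as `generic_row_eq_zero` requires.
  have h2 : ∑ i, S.coeff j₁.1 i e • (r ⟨j₁.1, i⟩ * s j₁.1) =
      (∑ i, S.coeff j₁.1 i e • (r ⟨j₁.1, i⟩ * mon j₁.1 e)) * (s j₁.1 / mon j₁.1 e) := by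
    rw [Finset.sum_mul]
    refine Finset.sum_congr rfl fun i _ => ?_
    rw [smul_mul_assoc]
    congr 1
    field_simp
  rw [h2, map_mul, map_div₀, hmt _ _ (he₀ e he), div_self (hνs _).ne', mul_one]
  exact h1

end GenSpliceDiagram

/-! ### Noetherian local rings of dimension two. -/

section LocalRing

variable {R : Type*} [CommRing R] [IsLocalRing R] [IsNoetherianRing R] {g : Fin 2 → R}

theorem ncard_range_le_two {α : Type*} (g : Fin 2 → α) : (Set.range g).ncard ≤ 2 := by
  rw [← Set.image_univ]
  refine (Set.ncard_image_le Set.finite_univ).trans ?_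
  simp

theorem ringKrullDim_le_two_of_mem_minimalPrimes
    (h : IsLocalRing.maximalIdeal R ∈ (Ideal.span (Set.range g)).minimalPrimes) :
    ringKrullDim R ≤ 2 := by
  rw [← IsLocalRing.maximalIdeal_height_eq_ringKrullDim]
  exact WithBot.coe_le_coe.2 ((Ideal.height_le_card_of_mem_minimalPrimes_span (Set.finite_range _)
    h).trans (Nat.cast_le.2 (ncard_range_le_two g)))

/-- By Nakayama's lemma the maximal ideal is generated by the two elements `g k`. -/
theorem isRegularLocalRing_of_maximalIdeal_le (hg : ∀ k, g k ∈ IsLocalRing.maximalIdeal R)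
    (h : IsLocalRing.maximalIdeal R ≤ Ideal.span (Set.range g) ⊔ IsLocalRing.maximalIdeal R ^ 2)
    (hdim : 2 ≤ ringKrullDim R) : IsRegularLocalRing R ∧ ringKrullDim R = 2 := by
  have hle : IsLocalRing.maximalIdeal R ≤ Ideal.span (Set.range g) := by
    refine Submodule.le_of_le_smul_of_le_jacobson_bot (I := IsLocalRing.maximalIdeal R)
      (IsNoetherian.noetherian _) (IsLocalRing.jacobson_eq_maximalIdeal ⊥ bot_ne_top).ge ?_
    rwa [smul_eq_mul, ← pow_two]
  have heq := le_antisymm hle (Ideal.span_le.2 (by rintro _ ⟨k, rfl⟩; exact hg k))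
  have hrank : (IsLocalRing.maximalIdeal R).spanFinrank ≤ 2 := by
    rw [heq]
    exact (Submodule.spanFinrank_span_le_ncard_of_finite (Set.finite_range _)).trans
      (ncard_range_le_two g)
  have hrank' : ((IsLocalRing.maximalIdeal R).spanFinrank : WithBot ℕ∞) ≤ 2 := by
    exact_mod_cast hrank
  exact ⟨.of_spanFinrank_maximalIdeal_le _ (hrank'.trans hdim),
    le_antisymm ((ringKrullDim_le_spanFinrank_maximalIdeal _).trans hrank') hdim⟩

variable {S ι : Type*} [CommRing S] {φ : S →+* R} {p : Ideal S} {f : ι → S} {g : Fin 2 → S}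

theorem ringKrullDim_le_two_of_forall_isPrime (hmap : p.map φ = IsLocalRing.maximalIdeal R)
    (hcomap : (IsLocalRing.maximalIdeal R).comap φ ≤ p) (hf : ∀ j, φ (f j) = 0)
    (hg : ∀ k, g k ∈ p) (hq : ∀ q : Ideal S, q.IsPrime → q ≤ p → (∀ j, f j ∈ q) →
      (∀ k, g k ∈ q) → q = p) : ringKrullDim R ≤ 2 := by
  refine ringKrullDim_le_two_of_mem_minimalPrimes (g := φ ∘ g)
    ⟨⟨inferInstance, Ideal.span_le.2 ?_⟩, ?_⟩
  · rintro _ ⟨k, rfl⟩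
    exact hmap ▸ Ideal.mem_map_of_mem _ (hg k)
  · rintro Q ⟨hQ, hgQ⟩ -
    have heq := hq _ (hQ.comap φ)
      ((Ideal.comap_mono (IsLocalRing.le_maximalIdeal hQ.ne_top)).trans hcomap)
      (fun j => by rw [Ideal.mem_comap, hf]; exact Q.zero_mem)
      (fun k => hgQ (Ideal.subset_span ⟨k, rfl⟩))
    rw [← hmap, ← heq]
    exact Ideal.map_comap_le

theorem isRegularLocalRing_of_le_span (hmap : p.map φ = IsLocalRing.maximalIdeal R)
    (hf : ∀ j, φ (f j) = 0) (hg : ∀ k, g k ∈ p)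
    (hp : p ≤ Ideal.span (Set.range f) ⊔ Ideal.span (Set.range g) ⊔ p ^ 2)
    (hdim : 2 ≤ ringKrullDim R) : IsRegularLocalRing R ∧ ringKrullDim R = 2 := by
  refine isRegularLocalRing_of_maximalIdeal_le (g := φ ∘ g)
    (fun k => hmap ▸ Ideal.mem_map_of_mem _ (hg k)) ?_ hdim
  rw [← hmap]
  refine (Ideal.map_mono hp).trans ?_
  rw [Ideal.map_sup, Ideal.map_sup, Ideal.map_pow, Ideal.map_span, Ideal.map_span,
    ← Set.range_comp, ← Set.range_comp]
  refine sup_le (sup_le ?_ le_sup_left) le_sup_right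
  rw [Ideal.span_le]
  rintro _ ⟨j, rfl⟩
  rw [Function.comp_apply, hf]
  exact Submodule.zero_mem _

end LocalRing

/-! ### Local rings of affine schemes and the Jacobian criterion. -/

section LocalAlgebra

variable {σ ι : Type*}

open MvPolynomial

theorem mem_pointIdeal {x : σ → ℂ} {p : MvPolynomial σ ℂ} : p ∈ pointIdeal x ↔ eval x p = 0 :=
  RingHom.mem_ker

/-- The automorphism of the polynomial ring that moves the point `x` to `x + a`. -/
noncomputable def translation (a : σ → ℂ) : MvPolynomial σ ℂ ≃ₐ[ℂ] MvPolynomial σ ℂ :=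
  AlgEquiv.ofAlgHom (aeval fun i => X i + C (a i)) (aeval fun i => X i - C (a i))
    (by ext i; simp [MvPolynomial.algebraMap_eq]) (by ext i; simp [MvPolynomial.algebraMap_eq])

theorem eval_translation (a x : σ → ℂ) (p : MvPolynomial σ ℂ) :
    eval x (translation a p) = eval (x + a) p := by
  have : (aeval x).comp (translation a : MvPolynomial σ ℂ ≃ₐ[ℂ] MvPolynomial σ ℂ).toAlgHom =
      aeval (x + a) := by
    ext i; simp [translation]
  simpa [aeval_eq_eval] using DFunLike.congr_fun this p

theorem height_pointIdeal_eq (x y : σ → ℂ) : (pointIdeal y).height = (pointIdeal x).height := by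
  rw [← RingEquiv.height_comap (translation (y - x)).toRingEquiv (pointIdeal x)]
  congr 1
  ext p
  rw [Ideal.mem_comap, mem_pointIdeal, mem_pointIdeal]
  have := eval_translation (y - x) x p
  rw [add_sub_cancel] at this
  rw [← this]
  rfl

/-- By the Nullstellensatz every maximal ideal belongs to a point, and translations give all of them
the same height, which is therefore the dimension of the polynomial ring. -/
theorem natCard_le_height_pointIdeal [Finite σ] (x : σ → ℂ) :
    (Nat.card σ : ℕ∞) ≤ (pointIdeal x).height := by
  have h : ringKrullDim (MvPolynomial σ ℂ) = Nat.card σ := by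
    rw [MvPolynomial.ringKrullDim_of_isNoetherianRing, ringKrullDim_eq_zero_of_field, zero_add]
  rw [← Ideal.sup_isMaximal_height_eq_ringKrullDim] at h
  have h' : (⨆ (I : Ideal (MvPolynomial σ ℂ)) (_ : I.IsMaximal), I.height) = Nat.card σ :=
    WithBot.coe_injective h
  rw [← h']
  refine iSup₂_le fun I hI => ?_
  obtain ⟨y, rfl⟩ := MvPolynomial.isMaximal_iff_eq_vanishingIdeal_singleton.1 hI
  rw [← height_pointIdeal_eq x y]
  refine Ideal.height_mono fun p hp => mem_pointIdeal.2 ?_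
  simpa [aeval_eq_eval] using hp

theorem X_sub_C_mem_pointIdeal (x : σ → ℂ) (i : σ) : X i - C (x i) ∈ pointIdeal x := by
  simp

theorem eval_add_linear_sub_mem_sq [Fintype σ] (x : σ → ℂ) (p : MvPolynomial σ ℂ) :
    p - C (eval x p) - ∑ i, C (eval x (pderiv i p)) * (X i - C (x i)) ∈ pointIdeal x ^ 2 := by
  classical
  induction p using MvPolynomial.induction_on with
  | C a => simp
  | add p q hp hq =>
    convert add_mem hp hq using 1
    simp only [map_add, add_mul, Finset.sum_add_distrib]
    ring
  | mul_X p j hp =>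
    have h1 : ∑ i, C (eval x (pderiv i (p * X j))) * (X i - C (x i)) =
        (∑ i, C (eval x (pderiv i p)) * (X i - C (x i))) * C (x j) +
          C (eval x p) * (X j - C (x j)) := by
      have : ∀ i, C (eval x (pderiv i (p * X j))) * (X i - C (x i)) =
          C (eval x (pderiv i p)) * (X i - C (x i)) * C (x j) +
          if j = i then C (eval x p) * (X i - C (x i)) else 0 := by
        intro i
        rw [Derivation.leibniz, pderiv_X]
        by_cases h : j = i
        · subst h; simp; ring
        · simp [h]; ring
      simp only [this, Finset.sum_add_distrib, ← Finset.sum_mul]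
      simp
    have h2 : (∑ i, C (eval x (pderiv i p)) * (X i - C (x i))) * (X j - C (x j)) ∈
        pointIdeal x ^ 2 := by
      rw [pow_two]
      exact Ideal.mul_mem_mul (Ideal.sum_mem _ fun i _ => Ideal.mul_mem_left _ _
        (X_sub_C_mem_pointIdeal x i)) (X_sub_C_mem_pointIdeal x j)
    convert add_mem (Ideal.mul_mem_right (X j) _ hp) h2 using 1
    rw [h1]
    simp only [map_mul, eval_X]
    ring

theorem mem_span_X_sub_C [Fintype σ] {x : σ → ℂ} {p : MvPolynomial σ ℂ} (hp : p ∈ pointIdeal x)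
    {N : Ideal (MvPolynomial σ ℂ)} (hN : pointIdeal x ^ 2 ≤ N)
    (hX : ∀ i, X i - C (x i) ∈ N) : p ∈ N := by
  have h := hN (eval_add_linear_sub_mem_sq x p)
  rw [mem_pointIdeal.1 hp, map_zero, sub_zero] at h
  exact (Submodule.sub_mem_iff_left _ (Ideal.sum_mem _ fun i _ => Ideal.mul_mem_left _ _ (hX i))).1 h

variable (f : ι → MvPolynomial σ ℂ) (x : σ → ℂ)

/-- The map from polynomials to germs at `x` of functions on the subscheme defined by `f`. -/
noncomputable def toLocal : MvPolynomial σ ℂ →+* LocalRingAt f x :=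
  (Ideal.Quotient.mk _).comp (algebraMap _ (Localization.AtPrime (pointIdeal x)))

variable {f x}

theorem toLocal_apply_eq_zero (j : ι) : toLocal f x (f j) = 0 := by
  rw [toLocal, RingHom.comp_apply, Ideal.Quotient.eq_zero_iff_mem]
  exact Ideal.mem_map_of_mem _ (Ideal.subset_span ⟨j, rfl⟩)

theorem map_span_le_maximalIdeal (hf : ∀ j, eval x (f j) = 0) :
    (Ideal.span (Set.range f)).map
      (algebraMap (MvPolynomial σ ℂ) (Localization.AtPrime (pointIdeal x))) ≤
      IsLocalRing.maximalIdeal _ := by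
  rw [← Localization.AtPrime.map_eq_maximalIdeal]
  refine Ideal.map_mono (Ideal.span_le.2 ?_)
  rintro _ ⟨j, rfl⟩
  exact mem_pointIdeal.2 (hf j)

theorem isLocalRing_localRingAt (hf : ∀ j, eval x (f j) = 0) : IsLocalRing (LocalRingAt f x) := by
  have : Nontrivial (LocalRingAt f x) := Ideal.Quotient.nontrivial_iff.2
    (ne_top_of_le_ne_top (IsLocalRing.maximalIdeal.isMaximal _).ne_top
      (map_span_le_maximalIdeal hf))
  exact IsLocalRing.of_surjective' (Ideal.Quotient.mk _) Ideal.Quotient.mk_surjective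

theorem isNoetherianRing_localRingAt [Finite σ] : IsNoetherianRing (LocalRingAt f x) := by
  have : IsNoetherianRing (Localization.AtPrime (pointIdeal x)) :=
    IsLocalization.isNoetherianRing (pointIdeal x).primeCompl _ inferInstance
  infer_instance

theorem map_toLocal_pointIdeal [IsLocalRing (LocalRingAt f x)] :
    (pointIdeal x).map (toLocal f x) = IsLocalRing.maximalIdeal (LocalRingAt f x) := by
  rw [toLocal, ← Ideal.map_map, Localization.AtPrime.map_eq_maximalIdeal]
  exact IsLocalRing.map_maximalIdeal_of_surjective _ Ideal.Quotient.mk_surjective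

/-- Each equation lowers the dimension by at most one. -/
theorem two_le_ringKrullDim_localRingAt [Finite σ] [Finite ι] (hf : ∀ j, eval x (f j) = 0)
    (hcard : Nat.card ι + 2 = Nat.card σ) : 2 ≤ ringKrullDim (LocalRingAt f x) := by
  have : IsNoetherianRing (Localization.AtPrime (pointIdeal x)) :=
    IsLocalization.isNoetherianRing (pointIdeal x).primeCompl _ inferInstance
  let φ := algebraMap (MvPolynomial σ ℂ) (Localization.AtPrime (pointIdeal x))
  have h1 := ringKrullDim_le_ringKrullDim_quotient_add_spanFinrank
    ((Ideal.span (Set.range f)).map φ) (by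
      rw [IsLocalRing.ringJacobson_eq_maximalIdeal]
      exact map_span_le_maximalIdeal hf)
  have h2 : (Nat.card σ : WithBot ℕ∞) ≤ ringKrullDim (Localization.AtPrime (pointIdeal x)) := by
    rw [IsLocalization.AtPrime.ringKrullDim_eq_height (pointIdeal x)]
    exact WithBot.coe_le_coe.2 (natCard_le_height_pointIdeal x)
  have h3 : ((Ideal.span (Set.range f)).map φ).spanFinrank ≤ Nat.card ι := by
    rw [Ideal.map_span, ← Set.range_comp]
    refine (Submodule.spanFinrank_span_le_ncard_of_finite (Set.finite_range _)).trans ?_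
    rw [← Set.image_univ, ← Set.ncard_univ]
    exact Set.ncard_image_le Set.finite_univ
  have h4 : ((Nat.card ι + 2 : ℕ) : WithBot ℕ∞) ≤
      ringKrullDim (LocalRingAt f x) + (Nat.card ι : ℕ) := by
    rw [hcard]
    refine h2.trans (h1.trans ?_)
    gcongr
  generalize ringKrullDim (LocalRingAt f x) = d at h4 ⊢
  induction d using WithBot.recBotCoe with
  | bot => simp at h4
  | coe d =>
    have h5 : ((Nat.card ι + 2 : ℕ) : ℕ∞) ≤ d + (Nat.card ι : ℕ) := WithBot.coe_le_coe.1 h4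
    refine WithBot.coe_le_coe.2 ?_
    rw [Nat.cast_add, add_comm] at h5
    exact (ENat.add_le_add_iff_right (ENat.natCast_ne_top _)).1 h5

theorem isUnit_toLocal {p : MvPolynomial σ ℂ} (hp : p ∉ pointIdeal x) :
    IsUnit (toLocal f x p) := by
  rw [toLocal, RingHom.comp_apply]
  have h := IsLocalization.map_units (Localization.AtPrime (pointIdeal x))
    (⟨p, hp⟩ : (pointIdeal x).primeCompl)
  exact RingHom.isUnit_map _ h

theorem comap_toLocal_maximalIdeal_le [IsLocalRing (LocalRingAt f x)] :
    (IsLocalRing.maximalIdeal (LocalRingAt f x)).comap (toLocal f x) ≤ pointIdeal x := by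
  intro p hp
  by_contra h
  exact (IsLocalRing.mem_maximalIdeal _).1 (Ideal.mem_comap.1 hp) (isUnit_toLocal h)

theorem ringKrullDim_localRingAt_le [Finite σ] (hf : ∀ j, eval x (f j) = 0)
    {g : Fin 2 → MvPolynomial σ ℂ} (hg : ∀ k, eval x (g k) = 0)
    (hq : ∀ q : Ideal (MvPolynomial σ ℂ), q.IsPrime → q ≤ pointIdeal x → (∀ j, f j ∈ q) →
      (∀ k, g k ∈ q) → q = pointIdeal x) : ringKrullDim (LocalRingAt f x) ≤ 2 := by
  have := isLocalRing_localRingAt hf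
  have := isNoetherianRing_localRingAt (f := f) (x := x)
  exact ringKrullDim_le_two_of_forall_isPrime (R := LocalRingAt f x) map_toLocal_pointIdeal
    comap_toLocal_maximalIdeal_le toLocal_apply_eq_zero (fun k => mem_pointIdeal.2 (hg k)) hq

/-- Modulo the square of the ideal of `x`, each `f j` is its gradient viewed as a linear form. The
`g k` are two linear forms spanning a complement of the gradients. -/
theorem exists_pointIdeal_le_of_jacobian [Finite σ] [Finite ι] (hf : ∀ j, eval x (f j) = 0)
    (hcard : Nat.card ι + 2 = Nat.card σ)
    (hJ : LinearIndependent ℂ fun j : ι => fun i : σ => eval x (pderiv i (f j))) :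
    ∃ g : Fin 2 → MvPolynomial σ ℂ, (∀ k, g k ∈ pointIdeal x) ∧
      pointIdeal x ≤ Ideal.span (Set.range f) ⊔ Ideal.span (Set.range g) ⊔ pointIdeal x ^ 2 := by
  classical
  have := Fintype.ofFinite σ
  have := Fintype.ofFinite ι
  set J : ι → σ → ℂ := fun j i => eval x (pderiv i (f j)) with hJdef
  obtain ⟨q, hq⟩ := Submodule.exists_isCompl (Submodule.span ℂ (Set.range J))
  have hq2 : Module.finrank ℂ q = 2 := by
    have h1 := Submodule.finrank_add_eq_of_isCompl hq
    rw [finrank_span_eq_card hJ, Module.finrank_fintype_fun_eq_card] at h1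
    rw [Nat.card_eq_fintype_card, Nat.card_eq_fintype_card] at hcard
    omega
  let b := Module.finBasisOfFinrankEq ℂ q hq2
  let Θ : (σ → ℂ) →ₗ[ℂ] MvPolynomial σ ℂ :=
    Fintype.linearCombination ℂ fun i => (X i - C (x i) : MvPolynomial σ ℂ)
  have hΘ : ∀ v, Θ v = ∑ i, C (v i) * (X i - C (x i)) := fun v => by
    rw [Fintype.linearCombination_apply]
    exact Finset.sum_congr rfl fun i _ => smul_eq_C_mul _ _
  let g : Fin 2 → MvPolynomial σ ℂ := fun k => Θ (b k)
  let N : Ideal (MvPolynomial σ ℂ) :=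
    (Ideal.span (Set.range f) ⊔ Ideal.span (Set.range g)) ⊔ pointIdeal x ^ 2
  have hN : ∀ v, Θ v ∈ N := by
    intro v
    have htop : (N.restrictScalars ℂ).comap Θ = ⊤ := by
      rw [eq_top_iff, ← hq.sup_eq_top, sup_le_iff, Submodule.span_le]
      constructor
      · rintro _ ⟨j, rfl⟩
        have h1 := eval_add_linear_sub_mem_sq x (f j)
        rw [hf j, map_zero, sub_zero] at h1
        have h2 : f j ∈ N := Ideal.mem_sup_left (Ideal.mem_sup_left (Ideal.subset_span ⟨j, rfl⟩))
        have h3 := N.sub_mem h2 (Ideal.mem_sup_right h1)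
        rw [sub_sub_cancel] at h3
        change Θ (J j) ∈ N
        rwa [hΘ]
      · have : q = (Submodule.span ℂ (Set.range b)).map q.subtype := by
          rw [b.span_eq, Submodule.map_top, Submodule.range_subtype]
        rw [this, Submodule.map_span, Submodule.span_le]
        rintro _ ⟨_, ⟨k, rfl⟩, rfl⟩
        exact Ideal.mem_sup_left (Ideal.mem_sup_right (Ideal.subset_span ⟨k, rfl⟩))
    have hv : v ∈ (N.restrictScalars ℂ).comap Θ := by rw [htop]; exact Submodule.mem_top
    exact hv
  have hle : pointIdeal x ≤ N := fun p hp => mem_span_X_sub_C hp le_sup_right fun i => by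
    have := hN (Pi.single i 1)
    rwa [hΘ, Fintype.sum_eq_single i fun j hj => by simp [hj], Pi.single_eq_same, map_one,
      one_mul] at this
  exact ⟨g, fun k => mem_pointIdeal.2 (by simp [g, hΘ]), hle⟩

/-- The Jacobian criterion for complete intersections of dimension two. -/
theorem isRegularLocalRing_of_jacobian [Finite σ] [Finite ι] (hf : ∀ j, eval x (f j) = 0)
    (hcard : Nat.card ι + 2 = Nat.card σ)
    (hJ : LinearIndependent ℂ fun j : ι => fun i : σ => eval x (pderiv i (f j))) :
    IsRegularLocalRing (LocalRingAt f x) ∧ ringKrullDim (LocalRingAt f x) = 2 := by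
  have := isLocalRing_localRingAt hf
  have := isNoetherianRing_localRingAt (f := f) (x := x)
  obtain ⟨g, hg, hle⟩ := exists_pointIdeal_le_of_jacobian hf hcard hJ
  exact isRegularLocalRing_of_le_span (R := LocalRingAt f x) map_toLocal_pointIdeal
    toLocal_apply_eq_zero hg hle (two_le_ringKrullDim_localRingAt hf hcard)

end LocalAlgebra

/-! ### Valuations from prime ideals and from ultrafilters. -/

section Places

open MvPolynomial

/-- Every prime ideal below the maximal ideal of the origin has a generic point at which the
coordinates are small with respect to some valuation that is trivial on the constants. -/
theorem exists_valuationSubring_of_isPrime {σ : Type*} {q : Ideal (MvPolynomial σ ℂ)} [q.IsPrime]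
    (hq : q ≤ pointIdeal 0) :
    ∃ B : ValuationSubring (FractionRing (MvPolynomial σ ℂ ⧸ q)),
      (∀ c : ℂ, B.valuation (algebraMap ℂ _ c) ≤ 1) ∧
      ∀ i, B.valuation (algebraMap (MvPolynomial σ ℂ ⧸ q) _ (Ideal.Quotient.mk q (X i))) < 1 := by
  let φ : MvPolynomial σ ℂ →+* FractionRing (MvPolynomial σ ℂ ⧸ q) :=
    (algebraMap (MvPolynomial σ ℂ ⧸ q) _).comp (Ideal.Quotient.mk q)
  have hφ : ∀ p, φ p = 0 ↔ p ∈ q := fun p => by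
    rw [RingHom.comp_apply, map_eq_zero_iff _ (IsFractionRing.injective _ _),
      Ideal.Quotient.eq_zero_iff_mem]
  have hne : (pointIdeal (0 : σ → ℂ)).map φ.rangeRestrict ≠ ⊤ := by
    rw [Ideal.ne_top_iff_one]
    intro h
    obtain ⟨p, hp, h1⟩ := (Ideal.mem_map_iff_of_surjective _ φ.rangeRestrict_surjective).1 h
    have h2 : φ (1 - p) = 0 := by
      rw [map_sub, map_one, sub_eq_zero]
      exact (congrArg Subtype.val h1).symm
    have h3 := hq ((hφ _).1 h2)
    rw [mem_pointIdeal, map_sub, map_one, mem_pointIdeal.1 hp, sub_zero] at h3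
    exact one_ne_zero h3
  -- A proper ideal of a subring of a field lies in the nonunits of a valuation ring containing that
  -- subring.
  obtain ⟨B, hB, hI⟩ := Ideal.image_subset_nonunits_valuationSubring _ hne
  refine ⟨B, fun c => (B.valuation_le_one_iff _).2 (hB ⟨C c, ?_⟩), fun i => ?_⟩
  · rfl
  · refine B.mem_nonunits_iff.1 (hI ⟨φ.rangeRestrict (X i), Ideal.mem_map_of_mem _ ?_, rfl⟩)
    simp

open Filter

variable {α : Type*} (𝓕 : Ultrafilter α)

/-- The constant germs make the germs along an ultrafilter into an algebra. -/
noncomputable instance germAlgebra : Algebra ℂ (Germ (𝓕 : Filter α) ℂ) :=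
  ((Germ.coeRingHom (𝓕 : Filter α)).comp (Pi.constRingHom α ℂ)).toAlgebra

/-- The valuation ring of bounded germs along an ultrafilter. -/
noncomputable def boundedGerms : ValuationSubring (Germ (𝓕 : Filter α) ℂ) where
  carrier := {a | ∃ (h : α → ℂ) (r : ℝ), a = (h : Germ (𝓕 : Filter α) ℂ) ∧ ∀ y, ‖h y‖ ≤ r}
  one_mem' := ⟨1, 1, rfl, by simp⟩
  zero_mem' := ⟨0, 0, rfl, by simp⟩
  add_mem' := by
    rintro _ _ ⟨h, r, rfl, hr⟩ ⟨k, s, rfl, hs⟩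
    exact ⟨h + k, r + s, rfl, fun y => (norm_add_le _ _).trans (add_le_add (hr y) (hs y))⟩
  mul_mem' := by
    rintro _ _ ⟨h, r, rfl, hr⟩ ⟨k, s, rfl, hs⟩
    refine ⟨h * k, r * s, rfl, fun y => ?_⟩
    rw [Pi.mul_apply, norm_mul]
    exact mul_le_mul (hr y) (hs y) (norm_nonneg _) ((norm_nonneg _).trans (hr y))
  neg_mem' := by
    rintro _ ⟨h, r, rfl, hr⟩
    exact ⟨-h, r, rfl, fun y => by simpa using hr y⟩
  mem_or_inv_mem' a := by
    induction a using Germ.inductionOn with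
    | _ h =>
    rcases 𝓕.em fun y => ‖h y‖ ≤ 1 with h1 | h1
    · refine .inl ⟨fun y => if ‖h y‖ ≤ 1 then h y else 0, 1, Germ.coe_eq.2 ?_, fun y => ?_⟩
      · filter_upwards [h1] with y hy
        rw [if_pos hy]
      · dsimp only
        split_ifs with hy
        · exact hy
        · simp
    · refine .inr ⟨fun y => if ‖h y‖ ≤ 1 then 0 else (h y)⁻¹, 1, ?_, fun y => ?_⟩
      · rw [← Germ.coe_inv]
        refine Germ.coe_eq.2 ?_
        filter_upwards [h1] with y hy
        rw [if_neg hy]; rfl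
      · dsimp only
        split_ifs with hy
        · simp
        · rw [norm_inv]
          exact inv_le_one_of_one_le₀ (not_le.1 hy).le

variable {𝓕}

theorem boundedGerms_valuation_algebraMap_le (c : ℂ) :
    (boundedGerms 𝓕).valuation (algebraMap ℂ _ c) ≤ 1 :=
  ((boundedGerms 𝓕).valuation_le_one_iff _).2 ⟨fun _ => c, ‖c‖, rfl, fun _ => le_rfl⟩

/-- Otherwise the inverse germ would be bounded, but an infinitesimal times a bounded germ cannot be
one. -/
theorem boundedGerms_valuation_lt {h : α → ℂ} (hh : Tendsto h 𝓕 (𝓝 0)) :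
    (boundedGerms 𝓕).valuation (h : Germ (𝓕 : Filter α) ℂ) < 1 := by
  by_contra hlt
  have h0 : (h : Germ (𝓕 : Filter α) ℂ) ≠ 0 := by
    intro h0
    rw [h0, map_zero] at hlt
    exact hlt zero_lt_one
  have hinv : (h : Germ (𝓕 : Filter α) ℂ)⁻¹ ∈ boundedGerms 𝓕 := by
    rw [← ValuationSubring.valuation_le_one_iff, map_inv₀]
    exact inv_le_one_of_one_le₀ (not_lt.1 hlt)
  obtain ⟨k, r, hk, hr⟩ := hinv
  have hmul : ((h * k : α → ℂ) : Germ (𝓕 : Filter α) ℂ) = ((1 : α → ℂ) : Germ (𝓕 : Filter α) ℂ) := by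
    rw [Germ.coe_mul, ← hk, mul_inv_cancel₀ h0, Germ.coe_one]
  have ht : Tendsto (fun y => ‖h y‖ * |r|) 𝓕 (𝓝 (0 * |r|)) := by
    have := hh.norm
    rw [norm_zero] at this
    exact this.mul_const _
  rw [zero_mul] at ht
  obtain ⟨y, hy1, hy2⟩ := ((ht.eventually_lt_const one_pos).and (Germ.coe_eq.1 hmul)).exists
  have hy3 : ‖h y‖ * ‖k y‖ = 1 := by
    rw [← norm_mul]
    have : h y * k y = 1 := hy2
    rw [this, norm_one]
  have hy4 : ‖h y‖ * ‖k y‖ ≤ ‖h y‖ * |r| :=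
    mul_le_mul_of_nonneg_left ((hr y).trans (le_abs_self r)) (norm_nonneg _)
  linarith

theorem aeval_germ {σ : Type*} (h : α → σ → ℂ) (p : MvPolynomial σ ℂ) :
    aeval (fun i => ((fun y => h y i : α → ℂ) : Germ (𝓕 : Filter α) ℂ)) p =
      ((fun y => eval (h y) p : α → ℂ) : Germ (𝓕 : Filter α) ℂ) := by
  induction p using MvPolynomial.induction_on with
  | C a => simp; rfl
  | add p q hp hq => rw [map_add, hp, hq, ← Germ.coe_add]; simp only [map_add]; rfl
  | mul_X p i hp => rw [map_mul, hp, aeval_X, ← Germ.coe_mul]; simp only [map_mul, eval_X]; rfl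

theorem eval_zero_monomial {σ : Type*} {m : σ →₀ ℕ} (hm : m ≠ 0) (c : ℂ) :
    eval 0 (monomial m c) = 0 := by
  obtain ⟨w, hw⟩ := Finsupp.ne_iff.1 hm
  rw [Finsupp.coe_zero, Pi.zero_apply] at hw
  rw [eval_monomial, Finsupp.prod,
    Finset.prod_eq_zero (Finsupp.mem_support_iff.2 hw) (by simp [hw]), mul_zero]

end Places

/-! ### The singularity at the origin. -/

namespace GenSpliceDiagram

variable {V : Type*} [Fintype V] {D : GenSpliceDiagram V} (S : D.System)

open MvPolynomial Filter

theorem eval_zero_equation (j : Σ v : D.Node, Fin (D.val v - 2)) : eval 0 (S.equation j) = 0 := by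
  have h0 : ∀ m : D.Leaf →₀ ℕ, D.monomialWeight j.1 m ≠ 0 → m ≠ 0 := by
    rintro _ h rfl
    exact h (by simp [monomialWeight])
  have hpos := D.nodeWeight_pos j.1.2
  rw [System.equation, map_add, map_sum, (S.higher j.1 j.2).as_sum, map_sum]
  rw [Finset.sum_eq_zero fun u _ => eval_zero_monomial (h0 _ ?_) _,
    Finset.sum_eq_zero fun m hm => eval_zero_monomial (h0 _ ?_) _, add_zero]
  · exact (hpos.trans (S.higher_weight j.1 j.2 m hm)).ne'
  · rw [(S.admissible j.1 u).2]; exact hpos.ne'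

/-- Two monomials at one node serve as parameters. A prime strictly below the ideal of the origin
and containing them and the equations would give a valued point contradicting `prod_ne_zero_or`. -/
theorem ringKrullDim_localRingAt_zero_le [Nonempty D.Node] :
    ringKrullDim (LocalRingAt S.equation 0) ≤ 2 := by
  obtain ⟨v⟩ := ‹Nonempty D.Node›
  obtain ⟨e₁, he₁, -, -⟩ := exists_third_nbr v.2 v v
  obtain ⟨e₂, he₂, hne, -⟩ := exists_third_nbr v.2 e₁ e₁
  let e : Fin 2 → D.nbrs v := ![⟨e₁, he₁⟩, ⟨e₂, he₂⟩]
  refine ringKrullDim_localRingAt_le (g := fun k => monomial (S.expo v (e k)) 1)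
    (eval_zero_equation S) (fun k => ?_) ?_
  · obtain ⟨w, hw⟩ := (S.admissible v (e k)).exists_ne_zero v.2
    exact eval_zero_monomial (fun h => hw (by rw [h]; rfl)) 1
  intro q hqp hq hf hg
  by_contra hne'
  obtain ⟨B, hC, hx₁⟩ := exists_valuationSubring_of_isPrime hq
  let x : D.Leaf → FractionRing (MvPolynomial D.Leaf ℂ ⧸ q) := fun i =>
    algebraMap (MvPolynomial D.Leaf ℂ ⧸ q) _ (Ideal.Quotient.mk q (X i))
  have hx : ∀ p, aeval x p = algebraMap (MvPolynomial D.Leaf ℂ ⧸ q) _ (Ideal.Quotient.mk q p) := by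
    intro p
    have : aeval x = (IsScalarTower.toAlgHom ℂ (MvPolynomial D.Leaf ℂ ⧸ q)
        (FractionRing (MvPolynomial D.Leaf ℂ ⧸ q))).comp (Ideal.Quotient.mkₐ ℂ q) := by
      ext i; simp [x]
    rw [this]; rfl
  have hx0 : ∀ p, aeval x p = 0 ↔ p ∈ q := fun p => by
    rw [hx, map_eq_zero_iff _ (IsFractionRing.injective _ _), Ideal.Quotient.eq_zero_iff_mem]
  have hx₀ : ∃ w, x w ≠ 0 := by
    by_contra! h
    refine hne' (le_antisymm hq fun p hp => ?_)
    rw [← hx0, show x = 0 from funext h]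
    have h1 := aeval_algebraMap_apply (A := ℂ) (FractionRing (MvPolynomial D.Leaf ℂ ⧸ q))
      (0 : D.Leaf → ℂ) p
    rw [aeval_eq_eval, mem_pointIdeal.1 hp, map_zero] at h1
    rw [← h1]
    congr 2
    funext i
    simp
  have hmon : ∀ k, ∏ w, x w ^ S.expo v (e k) w = 0 := fun k => by
    have := (hx0 _).2 (hg k)
    rwa [aeval_monomial, Finsupp.prod_fintype _ _ (by simp), map_one, one_mul] at this
  rcases prod_ne_zero_or hC hx₁ hx₀ (fun j => (hx0 _).2 (hf j)) v (e₁ := e 0) (e₂ := e 1)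
    (fun h => hne (congrArg Subtype.val h).symm) with h | h
  · exact h (hmon 0)
  · exact h (hmon 1)

/-- If bad points accumulate at the origin, take an ultrafilter on them converging there. The
coordinate functions form a point over the field of germs with infinitesimal, not all zero
coordinates, and pointwise row relations form a nonzero relation over that field. -/
theorem eventually_linearIndependent_jacobian :
    ∀ᶠ x in 𝓝[≠] (0 : D.Leaf → ℂ), (∀ j, eval x (S.equation j) = 0) →
      LinearIndependent ℂ fun j => fun w => eval x (pderiv w (S.equation j)) := by
  classical
  by_contra hbad
  have hfr : ∃ᶠ x in 𝓝[≠] (0 : D.Leaf → ℂ), ¬ ((∀ j, eval x (S.equation j) = 0) →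
      LinearIndependent ℂ fun j => fun w => eval x (pderiv w (S.equation j))) := not_eventually.1 hbad
  let bad : Set (D.Leaf → ℂ) := {x | ¬ ((∀ j, eval x (S.equation j) = 0) →
      LinearIndependent ℂ fun j => fun w => eval x (pderiv w (S.equation j)))}
  have hne : (𝓝[≠] (0 : D.Leaf → ℂ) ⊓ 𝓟 bad).NeBot := frequently_mem_iff_neBot.1 hfr
  let 𝓕 := Ultrafilter.of (𝓝[≠] (0 : D.Leaf → ℂ) ⊓ 𝓟 bad)
  have hle := Ultrafilter.of_le (𝓝[≠] (0 : D.Leaf → ℂ) ⊓ 𝓟 bad)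
  have h𝓕bad : ∀ᶠ x in (𝓕 : Filter (D.Leaf → ℂ)), x ∈ bad :=
    hle.trans inf_le_right (mem_principal_self bad)
  have h𝓕 : (𝓕 : Filter (D.Leaf → ℂ)) ≤ 𝓝[≠] 0 := hle.trans inf_le_left
  have h𝓕0 : Tendsto id (𝓕 : Filter (D.Leaf → ℂ)) (𝓝 0) := h𝓕.trans nhdsWithin_le_nhds
  have h𝓕ne : ∀ᶠ x in (𝓕 : Filter (D.Leaf → ℂ)), x ≠ 0 := h𝓕 self_mem_nhdsWithin
  have hrel : ∀ x ∈ bad, ∃ r : (Σ v : D.Node, Fin (D.val v - 2)) → ℂ,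
      (∀ w, ∑ j, r j * eval x (pderiv w (S.equation j)) = 0) ∧ r ≠ 0 := by
    intro x hx
    have h2 := (Classical.not_imp.1 hx).2
    rw [Fintype.not_linearIndependent_iff] at h2
    obtain ⟨r, hr, j, hj⟩ := h2
    refine ⟨r, fun w => ?_, fun h => hj (congrFun h j)⟩
    simpa using congrFun hr w
  choose! r hr hr0 using hrel
  let ξ : D.Leaf → Germ (𝓕 : Filter (D.Leaf → ℂ)) ℂ := fun w =>
    ((fun y => y w : (D.Leaf → ℂ) → ℂ) : Germ (𝓕 : Filter (D.Leaf → ℂ)) ℂ)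
  have hξ : ∀ p, aeval ξ p = ((fun y => eval y p : (D.Leaf → ℂ) → ℂ) :
      Germ (𝓕 : Filter (D.Leaf → ℂ)) ℂ) := fun p => aeval_germ (𝓕 := 𝓕) id p
  have hξ₁ : ∀ w, (boundedGerms 𝓕).valuation (ξ w) < 1 := fun w =>
    boundedGerms_valuation_lt ((continuous_apply w).tendsto' 0 0 rfl |>.comp h𝓕0)
  have hξ₀ : ∃ w, ξ w ≠ 0 := by
    by_contra! h
    have h1 : ∀ w, ∀ᶠ y in (𝓕 : Filter (D.Leaf → ℂ)), y w = 0 := fun w => Germ.coe_eq.1 (h w)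
    obtain ⟨y, hy, hy0⟩ := ((eventually_all.2 h1).and h𝓕ne).exists
    exact hy0 (funext hy)
  have hξf : ∀ j, aeval ξ (S.equation j) = 0 := fun j => by
    rw [hξ]
    refine Germ.coe_eq.2 ?_
    filter_upwards [h𝓕bad] with y hy
    exact (Classical.not_imp.1 hy).1 j
  have hR := jacobian_rows_independent boundedGerms_valuation_algebraMap_le hξ₁ hξ₀ hξf
    (r := fun j => ((fun y => r y j : (D.Leaf → ℂ) → ℂ) : Germ (𝓕 : Filter (D.Leaf → ℂ)) ℂ))
    fun w => by
      have h1 : ∀ j, ((fun y => r y j : (D.Leaf → ℂ) → ℂ) : Germ (𝓕 : Filter (D.Leaf → ℂ)) ℂ) *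
          aeval ξ (pderiv w (S.equation j)) =
          Germ.coeRingHom (𝓕 : Filter (D.Leaf → ℂ))
            (fun y => r y j * eval y (pderiv w (S.equation j))) := fun j => by rw [hξ]; rfl
      rw [Finset.sum_congr rfl fun j _ => h1 j, ← map_sum]
      refine Germ.coe_eq.2 ?_
      filter_upwards [h𝓕bad] with y hy
      rw [Finset.sum_apply]
      exact hr y hy w
  have h1 : ∀ j, ∀ᶠ y in (𝓕 : Filter (D.Leaf → ℂ)), r y j = 0 := fun j =>
    Germ.coe_eq.1 (congrFun hR j)
  obtain ⟨y, hy, hyb⟩ := ((eventually_all.2 h1).and h𝓕bad).exists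
  exact hr0 y hyb (funext hy)

theorem isIsolatedCISurfaceSingularity : IsIsolatedCISurfaceSingularity S.equation 0 where
  mem := eval_zero_equation S
  card_eq := D.card_equations
  dim_eq := by
    rcases isEmpty_or_nonempty D.Node with h | h
    -- Without nodes there are no equations, and the Jacobian criterion applies at the origin
    -- itself.
    · exact (isRegularLocalRing_of_jacobian (eval_zero_equation S) D.card_equations
        linearIndependent_empty_type).2
    · exact le_antisymm (ringKrullDim_localRingAt_zero_le S)
        (two_le_ringKrullDim_localRingAt (eval_zero_equation S) D.card_equations)
  isolated := by
    filter_upwards [eventually_linearIndependent_jacobian S] with x hx hf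
    exact isRegularLocalRing_of_jacobian hf D.card_equations (hx hf)

end GenSpliceDiagram

end Splice

theorem mainTheorem3 {V : Type*} [Fintype V] (D : Splice.GenSpliceDiagram V)
    (hD : D.SemigroupCondition) :
    Nonempty D.System ∧
      ∀ S : D.System, Splice.IsIsolatedCISurfaceSingularity S.equation 0 :=
  ⟨D.nonempty_system hD, Splice.GenSpliceDiagram.isIsolatedCISurfaceSingularity⟩
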